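/- **Setting.** Let $(E,\|\cdot\|)$ and $(F,|\cdot|)$ be real normed spaces (for instance $\mathbb R^n$ and $\mathbb R^m$ with arbitrary norms), $\mathcal X\subseteq E$ and $\mathcal Z\subseteq F$ closed convex sets, $\mathcal A\neq 0$ a bounded linear operator from $E$ to the dual of $F$, $\|\mathcal A\|$ its norm induced by $\|\cdot\|$ and $|\cdot|$, and $\mathcal A^\top$ its transpose. Consider $$\min_{x\in\mathcal X}\max_{z\in\mathcal Z}\ f(x)+\langle \mathcal A x,z\rangle-h(z),\qquad f=\tilde f+\mu\nu,\quad \mu\ge 0,$$ where $h:\mathcal Z\to\mathbb R$ is convex, $\tilde f:E\to\mathbb R$ is convex and differentiable with $\|\nabla\tilde f(x)-\nabla\tilde f(x')\|_*\le\tilde L\|x-x'\|$ for all $x,x'\in E$, $\tilde L>0$, and $\nu:\mathcal X\to\mathbb R$ is differentiable and strongly convex with modulus $1$ with respect to $\|\cdot\|$. Let $\zeta:\mathcal Z\to\mathbb R$ be differentiable and strongly convex with modulus $1$ with respect to $|\cdot|$. Let $\tilde f^*(y)=\sup_{x\in E}\{\langle x,y\rangle-\tilde f(x)\}$, let $\mathcal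 Y$ be the domain of $\tilde f^*$ (in the dual of $E$), and put $$V(\hat x,x)=\nu(x)-\nu(\hat x)-\langle\nu'(\hat x),x-\hat x\rangle,\quad U(\hat z,z)=\zeta(z)-\zeta(\hat z)-\langle\zeta'(\hat z),z-\hat z\rangle,$$ $$W_{g}(v,y)=\tilde f^*(y)-\tilde f^*(v)-\langle g,y-v\rangle .$$ **Algorithm (PDS).** Choose $x_0\in\mathcal X$, $y_0\in\mathcal Y$, $z_0\in\mathcal Z$, $\underline x_0\in E$; set $\hat x_0=x_{-1}=x_0$. For $k=1,\dots,N$: put $\tilde x_k=x_{k-1}+\lambda_k(\hat x_{k-1}-x_{k-2})$, $$y_k\in\operatorname*{argmin}_{y\in\mathcal Y}\ \langle-\tilde x_k,y\rangle+\tilde f^*(y)+\tau_kW_{\underline x_{k-1}}(y_{k-1},y),\qquad \underline x_k=\frac{\tilde x_k+\tau_k\underline x_{k-1}}{1+\tau_k};$$ set $x_k^0=x_{k-1}$, $z_k^0=z_{k-1}$, $x_1^{-1}=x_0$ and $x_k^{-1}=x_{k-1}^{T_{k-1}-1}$ for $k\ge2$; for $t=1,\dots,T_k$ put $\tilde u_k^t=x_k^{t-1}+\alpha_k^t(x_k^{t-1}-x_k^{t-2})$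 and $$z_k^t\in\operatorname*{argmin}_{z\in\mathcal Z}\ h(z)-\langle\mathcal A\tilde u_k^t,z\rangle+q_k^tU(z_k^{t-1},z),$$ $$x_k^t\in\operatorname*{argmin}_{x\in\mathcal X}\ \mu\nu(x)+\langle y_k+\mathcal A^\top z_k^t,x\rangle+\eta_k^tV(x_k^{t-1},x)+p_kV(x_{k-1},x);$$ then set $x_k=x_k^{T_k}$, $z_k=z_k^{T_k}$, $\hat x_k=\frac1{T_k}\sum_{t=1}^{T_k}x_k^t$, $\hat z_k=\frac1{T_k}\sum_{t=1}^{T_k}z_k^t$. The output is $\overline w_N=\big(\sum_{k=1}^N\beta_k\big)^{-1}\sum_{k=1}^N\beta_k(\hat x_k,y_k,\hat z_k)$. Each outer iteration $k$ counts as one evaluation of $\nabla\tilde f$ (at $\underline x_k$), and each inner iteration as one application of $\mathcal A$ and one of $\mathcal A^\top$. **Parameters.** Let $R>0$. If $\mu>0$ let $\tau=\sqrt{2\tilde L/\mu}$, $\Delta=\lceil 2\tau+1\rceil$, $\lambda=\tau/(1+\tau)$; if $\mu=0$ let $\Delta=+\infty$. For $k\le\Delta$: $$\tau_k=\tfrac{k-1}2,\quad\lambda_k=\tfrac{k-1}k,\quad\beta_k=k,\quad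 p_k=\tfrac{2\tilde L}k,\quad T_k=\Big\lceil\tfrac{kR\|\mathcal A\|}{\tilde L}\Big\rceil;$$ for $k>\Delta$: $$\tau_k=\tau,\quad\lambda_k=\lambda,\quad\beta_k=\Delta\lambda^{-(k-\Delta)},\quad p_k=\tfrac{\tilde L}{1+\tau},\quad T_k=\Big\lceil\tfrac{2(1+\tau)R\|\mathcal A\|}{\tilde L\lambda^{(k-\Delta)/2}}\Big\rceil;$$ and for all $k,t$: $\eta_k^t=(p_k+\mu)(t-1)+p_kT_k$, $q_k^t=\frac{\tilde LT_k}{2\beta_kR^2}$, $\alpha_k^t=\frac{\beta_{k-1}T_k}{\beta_kT_{k-1}}$ if $k\ge2$ and $t=1$, and $\alpha_k^t=1$ otherwise. **Gap function.** For $\hat w=(\hat x,\hat y,\hat z)$ and $w=(x,y,z)$, $$Q(\hat w,w)=\big[\mu\nu(\hat x)+\langle\hat x,y+\mathcal A^\top z\rangle-\tilde f^*(y)-h(z)\big]-\big[\mu\nu(x)+\langle x,\hat y+\mathcal A^\top\hat z\rangle-\tilde f^*(\hat y)-h(\hat z)\big].$$ **Theorem 4.2.** Every run of $N\ge1$ outer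 iterations with these parameters satisfies $y_k=\nabla\tilde f(\underline x_k)$ for $1\le k\le N$, $\overline w_N\in\mathcal X\times\mathcal Y\times\mathcal Z$, and, for all $w=(x,y,z)\in\mathcal X\times\mathcal Y\times\mathcal Z$, $$Q(\overline w_N,w)\le\min\Big\{\tfrac2{N^2},\lambda^{N-\Delta}\Big\}\Big[\tfrac{\tilde L}{2R^2}U(z_0,z)+4\tilde L\,V(x_0,x)\Big],$$ where the minimum is read as $2/N^2$ if $\mu=0$. Suppose moreover that $(x^*,z^*)$ is a saddle point of the problem, that $V(x_0,x^*)>0$, and that $R=\dfrac{|z^*|+1}{4\sqrt{V(x_0,x^*)}}$. For $\rho>0$ and $\varepsilon>0$ call $\hat w\in\mathcal X\times\mathcal Y\times\mathcal Z$ an $\varepsilon$-solution if $Q(\hat w,w)\le\varepsilon$ for all $w=(x,y,z)\in\mathcal X\times\mathcal Y\times\mathcal Z$ with $V(x_0,x)\le\rho V(x_0,x^*)$ and $U(z_0,z)\le\rho(|z^*|+1)^2$ (for large $\rho$ this includes $x=x^*$, $z=z^*$). Then, for every $\rho>0$ and every $0<\varepsilon\le\tilde LV(x_0,x^*)/2$,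 there is $N\ge1$ such that $\overline w_N$ is an $\varepsilon$-solution and the following holds. a) If $\mu=0$, the first $N$ outer iterations use at most $C\sqrt{\tilde LV(x_0,x^*)/\varepsilon}$ gradient evaluations and at most $C'\Big(\sqrt{\tilde LV(x_0,x^*)/\varepsilon}+\|\mathcal A\|/\varepsilon\Big)$ applications of $\mathcal A$ and $\mathcal A^\top$. b) If $0<\mu\le\kappa\tilde L$, where $\kappa>0$, they use at most $C\Big(1+\sqrt{2\tilde L/\mu}\,\log\frac{\tilde LV(x_0,x^*)}\varepsilon\Big)$ gradient evaluations and at most $C'\Big(1+\sqrt{2\tilde L/\mu}\,\log\frac{\tilde LV(x_0,x^*)}\varepsilon+\|\mathcal A\|\big(1+1/\sqrt\varepsilon\big)\Big)$ applications of $\mathcal A$ and $\mathcal A^\top$. Here $C$ depends only on $\rho$ in a) and only on $\rho$ and $\kappa$ in b), and $C'$ depends only on these, $\tilde L$, $\mu$, $V(x_0,x^*)$ and $|z^*|$; in particular neither depends on $N$, $\|\mathcal A\|$ or $\varepsilon$. -/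

import Mathlib

universe u v

noncomputable section

/-! ### The bilinearly coupled saddle point problem -/

/-- The problem `min_{x ∈ X} max_{z ∈ Z} f(x) + ⟨A x, z⟩ - h(z)` with `f = ft + μ ν`, together with
the function `ζ` that generates the prox-function on `Z`.
The norm `‖·‖` on the `x`-space is the norm of `E`, the norm `|·|` on the `z`-space is that of `F`.
All pairings are duality pairings: `⟨x, y⟩ = y x` for `y` in the dual of `E`, and `A` maps `E` to the
dual of `F`, so that `⟨A x, z⟩ = A x z`, `Aᵀ z = A.flip z`, the norm of `y` is the dual norm, and `‖A‖`
is the operator norm induced by `‖·‖` and `|·|`. -/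
structure BilinearSPP (E : Type u) [NormedAddCommGroup E] [NormedSpace ℝ E]
    (F : Type v) [NormedAddCommGroup F] [NormedSpace ℝ F] where
  X : Set E
  Z : Set F
  A : E →L[ℝ] StrongDual ℝ F
  /-- the smooth part of the objective -/
  ft : E → ℝ
  /-- the Lipschitz constant of the gradient of `ft` -/
  L : ℝ
  μ : ℝ
  ν : E → ℝ
  h : F → ℝ
  ζ : F → ℝ
  X_closed : IsClosed X
  X_convex : Convex ℝ X
  Z_closed : IsClosed Z
  Z_convex : Convex ℝ Z
  ft_convex : ConvexOn ℝ Set.univ ft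
  ft_differentiable : Differentiable ℝ ft
  L_pos : 0 < L
  ft_lipschitz : ∀ x x' : E, ‖fderiv ℝ ft x - fderiv ℝ ft x'‖ ≤ L * ‖x - x'‖
  μ_nonneg : 0 ≤ μ
  ν_strongConvex : StrongConvexOn X 1 ν
  ν_differentiable : DifferentiableOn ℝ ν X
  h_convex : ConvexOn ℝ Z h
  ζ_strongConvex : StrongConvexOn Z 1 ζ
  ζ_differentiable : DifferentiableOn ℝ ζ Z

/-- The prox-function (Bregman distance)
`φ(b) - φ(a) - ⟨φ'(a), b - a⟩` of `φ` on the set `s`. -/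
def bregman {G : Type*} [NormedAddCommGroup G] [NormedSpace ℝ G]
    (φ : G → ℝ) (s : Set G) (a b : G) : ℝ :=
  φ b - φ a - fderivWithin ℝ φ s a (b - a)

/-- `a` is a minimizer of `φ` over `s`. -/
def IsArgmin {G : Type*} (φ : G → ℝ) (s : Set G) (a : G) : Prop :=
  a ∈ s ∧ ∀ b ∈ s, φ a ≤ φ b

namespace BilinearSPP

variable {E : Type u} [NormedAddCommGroup E] [NormedSpace ℝ E]
  {F : Type v} [NormedAddCommGroup F] [NormedSpace ℝ F]

/-- The prox-function on `X` generated by `ν`. -/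
def V (S : BilinearSPP E F) (a b : E) : ℝ := bregman S.ν S.X a b

/-- The prox-function on `Z` generated by `ζ`. -/
def U (S : BilinearSPP E F) (a b : F) : ℝ := bregman S.ζ S.Z a b

/-- The domain of the convex conjugate of `ft`. -/
def Y (S : BilinearSPP E F) : Set (StrongDual ℝ E) :=
  {y | BddAbove (Set.range fun x : E => y x - S.ft x)}

/-- The convex conjugate of `ft` (a real number at the points of its domain `Y`). -/
def ftConj (S : BilinearSPP E F) (y : StrongDual ℝ E) : ℝ := ⨆ x : E, (y x - S.ft x)

/-- The prox-function of the conjugate of `ft` at `v`, taken with the subgradient `g` at `v`. -/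
def W (S : BilinearSPP E F) (g : E) (v y : StrongDual ℝ E) : ℝ :=
  S.ftConj y - S.ftConj v - (y - v) g

/-- The saddle function `f(x) + ⟨A x, z⟩ - h(z)`. -/
def saddleFun (S : BilinearSPP E F) (x : E) (z : F) : ℝ :=
  (S.ft x + S.μ * S.ν x) + S.A x z - S.h z

/-- `(xs, zs)` is a saddle point of the problem. -/
def IsSaddlePoint (S : BilinearSPP E F) (xs : E) (zs : F) : Prop :=
  xs ∈ S.X ∧ zs ∈ S.Z ∧
    (∀ z ∈ S.Z, S.saddleFun xs z ≤ S.saddleFun xs zs) ∧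
    (∀ x ∈ S.X, S.saddleFun xs zs ≤ S.saddleFun x zs)

/-- The feasible set `X × Y × Z`. -/
def feasible (S : BilinearSPP E F) : Set (E × StrongDual ℝ E × F) := S.X ×ˢ (S.Y ×ˢ S.Z)

/-- The gap function `Q(w', w)`. -/
def gap (S : BilinearSPP E F) : E × StrongDual ℝ E × F → E × StrongDual ℝ E × F → ℝ
  | (x', y', z'), (x, y, z) =>
    (S.μ * S.ν x' + (y + S.A.flip z) x' - S.ftConj y - S.h z)
      - (S.μ * S.ν x + (y' + S.A.flip z') x - S.ftConj y' - S.h z')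

/-- `w'` is feasible and its gap is at most `ε` against every feasible `w = (x, y, z)` with
`V(x₀, x) ≤ ρ V(x₀, x*)` and `U(z₀, z) ≤ ρ (|z*| + 1)²`. -/
def IsEpsSolution (S : BilinearSPP E F) (x₀ : E) (z₀ : F) (xs : E) (zs : F) (ρ ε : ℝ)
    (w' : E × StrongDual ℝ E × F) : Prop :=
  w' ∈ S.feasible ∧
    ∀ x ∈ S.X, ∀ y ∈ S.Y, ∀ z ∈ S.Z,
      S.V x₀ x ≤ ρ * S.V x₀ xs → S.U z₀ z ≤ ρ * (‖zs‖ + 1) ^ 2 →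
        S.gap w' (x, y, z) ≤ ε

end BilinearSPP

/-! ### The primal dual sliding algorithm -/

/-- The parameters of the algorithm; outer index `k ≥ 1`, inner index `t ≥ 1`. -/
structure PDSParams where
  τ : ℕ → ℝ
  lam : ℕ → ℝ
  β : ℕ → ℝ
  p : ℕ → ℝ
  T : ℕ → ℕ
  η : ℕ → ℕ → ℝ
  q : ℕ → ℕ → ℝ
  α : ℕ → ℕ → ℝ

/-- The sequences generated by the algorithm. -/
structure PDSIterates (E : Type u) [NormedAddCommGroup E] [NormedSpace ℝ E]
    (F : Type v) [NormedAddCommGroup F] [NormedSpace ℝ F] where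
  /-- `x_k`, `k ≥ 0` -/
  x : ℕ → E
  /-- `z_k`, `k ≥ 0` -/
  z : ℕ → F
  /-- `y_k`, `k ≥ 0` -/
  y : ℕ → StrongDual ℝ E
  /-- the subgradient of the conjugate of `ft` that is used at `y_k`, `k ≥ 0` -/
  g : ℕ → E
  /-- `x_k^t`, `k ≥ 1`, `0 ≤ t ≤ T_k` -/
  xIn : ℕ → ℕ → E
  /-- `z_k^t`, `k ≥ 1`, `0 ≤ t ≤ T_k` -/
  zIn : ℕ → ℕ → F

/-- A call of one of the oracles: the gradient of `ft` at a point, `A` at a point,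
or `Aᵀ` at a point. -/
inductive OracleCall (E : Type u) (F : Type v) where
  | gradient (x : E)
  | operator (x : E)
  | adjoint (z : F)

/-- Is the call a gradient evaluation (rather than an application of `A` or `Aᵀ`)? -/
def OracleCall.isGradient {E : Type u} {F : Type v} : OracleCall E F → Bool
  | .gradient _ => true
  | .operator _ => false
  | .adjoint _ => false

namespace PDSIterates

variable {E : Type u} [NormedAddCommGroup E] [NormedSpace ℝ E]
  {F : Type v} [NormedAddCommGroup F] [NormedSpace ℝ F]

/-- The inner average of the `x_k^t`, with value `x_0` for `k = 0`. -/
def xHat (r : PDSIterates E F) (P : PDSParams) (k : ℕ) : E :=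
  if k = 0 then r.x 0 else (P.T k : ℝ)⁻¹ • ∑ t ∈ Finset.Icc 1 (P.T k), r.xIn k t

/-- The inner average of the `z_k^t`, `k ≥ 1`. -/
def zHat (r : PDSIterates E F) (P : PDSParams) (k : ℕ) : F :=
  (P.T k : ℝ)⁻¹ • ∑ t ∈ Finset.Icc 1 (P.T k), r.zIn k t

/-- The extrapolated point `x_{k-1} + λ_k (xHat_{k-1} - x_{k-2})`, `k ≥ 1`, where `x_{-1} = x_0`. -/
def xTilde (r : PDSIterates E F) (P : PDSParams) (k : ℕ) : E :=
  r.x (k - 1) + P.lam k • (r.xHat P (k - 1) - (if k = 1 then r.x 0 else r.x (k - 2)))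

/-- The point `x_k^{-1}`, `k ≥ 1`. -/
def xInNeg (r : PDSIterates E F) (P : PDSParams) (k : ℕ) : E :=
  if k = 1 then r.x 0 else r.xIn (k - 1) (P.T (k - 1) - 1)

/-- The extrapolated inner point `x_k^{t-1} + α_k^t (x_k^{t-1} - x_k^{t-2})`, `k, t ≥ 1`. -/
def uTilde (r : PDSIterates E F) (P : PDSParams) (k t : ℕ) : E :=
  r.xIn k (t - 1) +
    P.α k t • (r.xIn k (t - 1) - (if t = 1 then r.xInNeg P k else r.xIn k (t - 2)))

/-- The sequences are produced by `N` outer iterations of the algorithm with parameters `P`,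
started at `x₀`, `z₀`. The prox-function `W(y_{k-1}, ·)` is taken with the subgradient `g_{k-1}`,
and `g_k = (xTilde_k + τ_k g_{k-1}) / (1 + τ_k)` is the subgradient at `y_k` that the optimality
condition of the `y`-step singles out (for `τ_1 = 0` neither `y_0` nor `g_0` matters). -/
structure IsRun (r : PDSIterates E F) (S : BilinearSPP E F) (P : PDSParams)
    (x₀ : E) (z₀ : F) (N : ℕ) : Prop where
  x_zero : r.x 0 = x₀
  x_zero_mem : x₀ ∈ S.X
  z_zero : r.z 0 = z₀
  z_zero_mem : z₀ ∈ S.Z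
  y_zero_mem : r.y 0 ∈ S.Y
  y_step : ∀ k, 1 ≤ k → k ≤ N →
    IsArgmin (fun y => -(y (r.xTilde P k)) + S.ftConj y
      + P.τ k * S.W (r.g (k - 1)) (r.y (k - 1)) y) S.Y (r.y k)
  g_step : ∀ k, 1 ≤ k → k ≤ N →
    r.g k = (1 + P.τ k)⁻¹ • (r.xTilde P k + P.τ k • r.g (k - 1))
  xIn_zero : ∀ k, 1 ≤ k → k ≤ N → r.xIn k 0 = r.x (k - 1)
  zIn_zero : ∀ k, 1 ≤ k → k ≤ N → r.zIn k 0 = r.z (k - 1)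
  z_step : ∀ k, 1 ≤ k → k ≤ N → ∀ t, 1 ≤ t → t ≤ P.T k →
    IsArgmin (fun z => S.h z + -(S.A (r.uTilde P k t) z)
      + P.q k t * S.U (r.zIn k (t - 1)) z) S.Z (r.zIn k t)
  x_step : ∀ k, 1 ≤ k → k ≤ N → ∀ t, 1 ≤ t → t ≤ P.T k →
    IsArgmin (fun x => S.μ * S.ν x + (r.y k + S.A.flip (r.zIn k t)) x
      + P.η k t * S.V (r.xIn k (t - 1)) x + P.p k * S.V (r.x (k - 1)) x) S.X (r.xIn k t)
  x_last : ∀ k, 1 ≤ k → k ≤ N → r.x k = r.xIn k (P.T k)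
  z_last : ∀ k, 1 ≤ k → k ≤ N → r.z k = r.zIn k (P.T k)

/-- The output after `N` outer iterations. -/
def output (r : PDSIterates E F) (P : PDSParams) (N : ℕ) : E × StrongDual ℝ E × F :=
  (∑ k ∈ Finset.Icc 1 N, P.β k)⁻¹ •
    ∑ k ∈ Finset.Icc 1 N, P.β k • (r.xHat P k, r.y k, r.zHat P k)

/-- The oracle calls made in the first `N` outer iterations, in order: outer iteration `k` evaluates
one gradient of `ft`, at `g_k`, and each of its `T_k` inner iterations applies `A` to `uTilde_k^t` and
`Aᵀ` to `z_k^t`. -/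
def oracleCalls (r : PDSIterates E F) (P : PDSParams) : ℕ → List (OracleCall E F)
  | 0 => []
  | k + 1 => r.oracleCalls P k ++
      (OracleCall.gradient (r.g (k + 1)) ::
        (List.range (P.T (k + 1))).flatMap fun t =>
          [OracleCall.operator (r.uTilde P (k + 1) (t + 1)),
            OracleCall.adjoint (r.zIn (k + 1) (t + 1))])

/-- The number of gradient evaluations in the first `N` outer iterations. -/
def gradientEvals (r : PDSIterates E F) (P : PDSParams) (N : ℕ) : ℕ :=
  (r.oracleCalls P N).countP fun c => c.isGradient

/-- The number of applications of `A` and `Aᵀ` in the first `N` outer iterations. -/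
def operatorEvals (r : PDSIterates E F) (P : PDSParams) (N : ℕ) : ℕ :=
  (r.oracleCalls P N).countP fun c => !c.isGradient

end PDSIterates

/-! ### The choice of the parameters -/

/-- `τ = √(2L/μ)` (used for `μ > 0` only). -/
def pdsTau (L μ : ℝ) : ℝ := √(2 * L / μ)

/-- `Δ = ⌈2τ + 1⌉` (used for `μ > 0` only; `Δ = +∞` for `μ = 0`). -/
def pdsDelta (L μ : ℝ) : ℕ := ⌈2 * pdsTau L μ + 1⌉₊

/-- `λ = τ / (1 + τ)` (used for `μ > 0` only). -/
def pdsLam (L μ : ℝ) : ℝ := pdsTau L μ / (1 + pdsTau L μ)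

/-- `k ≤ Δ`, where `Δ = +∞` for `μ = 0`. -/
def PDSEarly (L μ : ℝ) (k : ℕ) : Prop := μ = 0 ∨ k ≤ pdsDelta L μ

open Classical in
def pdsBeta (L μ : ℝ) (k : ℕ) : ℝ :=
  if PDSEarly L μ k then (k : ℝ)
  else (pdsDelta L μ : ℝ) * pdsLam L μ ^ (-((k : ℤ) - (pdsDelta L μ : ℤ)))

open Classical in
def pdsP (L μ : ℝ) (k : ℕ) : ℝ :=
  if PDSEarly L μ k then 2 * L / (k : ℝ) else L / (1 + pdsTau L μ)

open Classical in
/-- The inner iteration numbers `T_k`; here `a` stands for `‖A‖`. -/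
def pdsT (L μ R a : ℝ) (k : ℕ) : ℕ :=
  if PDSEarly L μ k then ⌈(k : ℝ) * R * a / L⌉₊
  else ⌈2 * (1 + pdsTau L μ) * R * a /
    (L * pdsLam L μ ^ (((k : ℝ) - (pdsDelta L μ : ℝ)) / 2))⌉₊

open Classical in
/-- The parameters of the algorithm for given `L`, `μ`, `R` and `a = ‖A‖`. -/
def pdsParams (L μ R a : ℝ) : PDSParams where
  τ k := if PDSEarly L μ k then ((k : ℝ) - 1) / 2 else pdsTau L μ
  lam k := if PDSEarly L μ k then ((k : ℝ) - 1) / (k : ℝ) else pdsLam L μ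
  β := pdsBeta L μ
  p := pdsP L μ
  T := pdsT L μ R a
  η k t := (pdsP L μ k + μ) * ((t : ℝ) - 1) + pdsP L μ k * (pdsT L μ R a k : ℝ)
  q k _ := L * (pdsT L μ R a k : ℝ) / (2 * pdsBeta L μ k * R ^ 2)
  α k t :=
    if 2 ≤ k ∧ t = 1 then
      pdsBeta L μ (k - 1) * (pdsT L μ R a k : ℝ) / (pdsBeta L μ k * (pdsT L μ R a (k - 1) : ℝ))
    else 1

open Classical in
/-- The rate `min {2/N², λ^(N-Δ)}`, which is `2/N²` for `μ = 0`. -/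
def pdsRate (L μ : ℝ) (N : ℕ) : ℝ :=
  if μ = 0 then 2 / (N : ℝ) ^ 2
  else min (2 / (N : ℝ) ^ 2) (pdsLam L μ ^ ((N : ℤ) - (pdsDelta L μ : ℤ)))

end

/-! ### First order conditions along segments -/

/-! Every step of the algorithm is a prox step, and every prox step yields a three point inequality.
For fixed `y_k`, one inner iteration bounds the inner gap by differences of the prox-functions plus
the bilinear error ⟨A(x^t - x^{t-1} - α d), z - z^t⟩, where d is the preceding increment of x. The
extrapolation makes this error a difference of consecutive terms plus a mixed term, which Young's
inequality absorbs into the strong convexity of ζ and ν. The factor α at t = 1 keeps this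
telescoping across outer iterations. Summing over t and applying Jensen (`inner_average_le`) leaves
the reserve -β_k p_k/2 ‖x̂_k - x_{k-1}‖² in outer iteration k.

The y-step is a prox step in the geometry of the conjugate, which is strongly convex because `ft` is
smooth. Its extrapolation error again telescopes up to a mixed term, paid for by W and by that
reserve (`dual_step_succ`). Adding both estimates gives ∑ β_k Q(ŵ_k, w) ≤ c U(z₀, z) + 4L V(x₀, x)
with c = L/(2R²) (`sum_gap_le`). Convexity of Q(·, w) permits division by ∑ β_k, which is at least
N²/2 and, for μ > 0, at least λ^{-(N-Δ)} (`inv_sum_pdsBeta_le_rate`). All that telescoping demands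
of the parameters is collected in `PDSParams.Conditions` and verified in `pdsParams_conditions`.

For the complexity, the choice of R makes both prox terms multiples of L V(x₀, x*), so the rate
fixes N. The costs are N gradients and 2 ∑ T_k operator applications. The sum is O(N + N²‖A‖) for μ
= 0, hence 1/ε. For μ > 0 its late part is geometric with ratio λ^{-1/2}, while the gap shrinks with
ratio λ, hence 1/√ε. -/

theorem HasDerivWithinAt.nonneg_of_forall_le {φ : ℝ → ℝ} {φ' : ℝ}
    (hd : HasDerivWithinAt φ φ' (Set.Icc 0 1) 0) (hmin : ∀ t ∈ Set.Icc (0 : ℝ) 1, φ 0 ≤ φ t) :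
    0 ≤ φ' := by
  have hloc : IsLocalMinOn φ (Set.Icc 0 1) 0 := by
    filter_upwards [self_mem_nhdsWithin] with t ht using hmin t ht
  have h1 : (1 : ℝ) ∈ posTangentConeAt (Set.Icc (0 : ℝ) 1) 0 := by
    apply mem_posTangentConeAt_of_segment_subset
    rw [zero_add, segment_eq_Icc zero_le_one]
  simpa using hloc.hasFDerivWithinAt_nonneg hd.hasFDerivWithinAt h1

/-! ### Bregman distances and three point inequalities -/

section Bregman

variable {G : Type*} [NormedAddCommGroup G] [NormedSpace ℝ G]

theorem Convex.segment_point_mem {s : Set G} (hs : Convex ℝ s) {a b : G} (ha : a ∈ s) (hb : b ∈ s)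
    {t : ℝ} (ht : t ∈ Set.Icc (0 : ℝ) 1) : a + t • (b - a) ∈ s :=
  hs.add_smul_sub_mem ha hb ht

theorem HasFDerivWithinAt.hasDerivWithinAt_segment {s : Set G} (hs : Convex ℝ s) {ω : G → ℝ}
    {ω' : G →L[ℝ] ℝ} {a b : G} (ha : a ∈ s) (hb : b ∈ s) (hω : HasFDerivWithinAt ω ω' s a) :
    HasDerivWithinAt (fun t : ℝ => ω (a + t • (b - a))) (ω' (b - a)) (Set.Icc 0 1) 0 := by
  have hline : HasDerivWithinAt (fun t : ℝ => a + t • (b - a)) (b - a) (Set.Icc 0 1) 0 := by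
    simpa using (((hasDerivAt_id (0 : ℝ)).smul_const (b - a)).const_add a).hasDerivWithinAt
  refine HasFDerivWithinAt.comp_hasDerivWithinAt (t := s) (0 : ℝ) ?_ hline ?_
  · simpa using hω
  · intro t ht
    exact hs.segment_point_mem ha hb ht

/-- The first order condition for the minimizer of a convex function plus a differentiable one. -/
theorem IsArgmin.le_add_fderiv {s : Set G} {f h ω : G → ℝ} {ω' : G →L[ℝ] ℝ} {u b : G}
    (hh : ConvexOn ℝ s h) (hf : ∀ a ∈ s, f a = h a + ω a) (hu : IsArgmin f s u)
    (hω : HasFDerivWithinAt ω ω' s u) (hb : b ∈ s) : h u ≤ h b + ω' (b - u) := by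
  have hs := hh.1
  -- `h` need not be differentiable. Replacing it along the segment by its chord only increases the
  -- objective and changes nothing at t = 0, so minimality passes to a differentiable function of t.
  have hd : HasDerivWithinAt (fun t : ℝ => t * (h b - h u) + ω (u + t • (b - u)))
      ((h b - h u) + ω' (b - u)) (Set.Icc 0 1) 0 := by
    refine HasDerivWithinAt.add ?_ (hω.hasDerivWithinAt_segment hs hu.1 hb)
    simpa using ((hasDerivAt_id (0 : ℝ)).mul_const (h b - h u)).hasDerivWithinAt
  have := hd.nonneg_of_forall_le fun t ht => by
    have hm := hs.segment_point_mem hu.1 hb ht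
    have h1 := hu.2 _ hm
    rw [hf _ hu.1, hf _ hm] at h1
    have h2 := hh.2 hu.1 hb (sub_nonneg.2 ht.2) ht.1 (by ring)
    have h3 : (1 - t) • u + t • b = u + t • (b - u) := by module
    rw [h3] at h2
    simp only [smul_eq_mul] at h2
    simp only [zero_mul, zero_smul, add_zero, zero_add]
    linarith
  linarith

/-- Along the segment, the strongly convex chord bound minus φ is nonnegative up to the constant φ
a, with equality at t = 0. Its one-sided derivative there is therefore nonnegative, which is the
claim. -/
theorem half_sq_norm_le_bregman {φ : G → ℝ} {s : Set G} (hφ : StrongConvexOn s 1 φ)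
    (hd : DifferentiableOn ℝ φ s) {a b : G} (ha : a ∈ s) (hb : b ∈ s) :
    ‖b - a‖ ^ 2 / 2 ≤ bregman φ s a b := by
  have hω := (hd a ha).hasFDerivWithinAt.hasDerivWithinAt_segment hφ.1 ha hb
  have h1 : HasDerivWithinAt (fun t : ℝ => t * (φ b - φ a) - t * (1 - t) * (‖b - a‖ ^ 2 / 2))
      ((φ b - φ a) - ‖b - a‖ ^ 2 / 2) (Set.Icc 0 1) 0 := by
    have h2 : HasDerivAt (fun t : ℝ => t * (φ b - φ a)) (φ b - φ a) 0 := by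
      simpa using (hasDerivAt_id (0 : ℝ)).mul_const (φ b - φ a)
    have h3 : HasDerivAt (fun t : ℝ => t * (1 - t) * (‖b - a‖ ^ 2 / 2)) (‖b - a‖ ^ 2 / 2) 0 := by
      simpa using ((hasDerivAt_id (0 : ℝ)).mul ((hasDerivAt_id (0 : ℝ)).const_sub 1)).mul_const
        (‖b - a‖ ^ 2 / 2)
    exact (h2.sub h3).hasDerivWithinAt
  have := (h1.sub hω).nonneg_of_forall_le fun t ht => by
    have h2 := hφ.2 ha hb (sub_nonneg.2 ht.2) ht.1 (by ring)
    have h3 : (1 - t) • a + t • b = a + t • (b - a) := by module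
    rw [h3, norm_sub_rev] at h2
    simp only [smul_eq_mul] at h2
    simp only [Pi.sub_apply, zero_mul, zero_smul, add_zero, zero_sub]
    linarith
  unfold bregman
  linarith

theorem bregman_nonneg {φ : G → ℝ} {s : Set G} (hφ : StrongConvexOn s 1 φ)
    (hd : DifferentiableOn ℝ φ s) {a b : G} (ha : a ∈ s) (hb : b ∈ s) : 0 ≤ bregman φ s a b :=
  (by positivity : (0 : ℝ) ≤ ‖b - a‖ ^ 2 / 2).trans (half_sq_norm_le_bregman hφ hd ha hb)

/-- Three point inequality for a prox step with one prox term. -/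
theorem IsArgmin.bregman_three_point {s : Set G} {h φ : G → ℝ} {l : G →L[ℝ] ℝ} {q : ℝ} {a u b : G}
    (hh : ConvexOn ℝ s h) (hd : DifferentiableOn ℝ φ s)
    (hu : IsArgmin (fun z => h z + l z + q * bregman φ s a z) s u) (hb : b ∈ s) :
    h u + l u + q * bregman φ s a u + q * bregman φ s u b ≤
      h b + l b + q * bregman φ s a b := by
  have hω : HasFDerivWithinAt (fun z => l z + q * bregman φ s a z)
      (l + q • (fderivWithin ℝ φ s u - fderivWithin ℝ φ s a)) s u := by
    refine l.hasFDerivAt.hasFDerivWithinAt.add (HasFDerivWithinAt.const_mul ?_ q)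
    refine HasFDerivWithinAt.sub ((hd u hu.1).hasFDerivWithinAt.sub_const _) ?_
    exact ((fderivWithin ℝ φ s a).hasFDerivAt.comp u
      ((hasFDerivAt_id u).sub_const a)).hasFDerivWithinAt
  have := hu.le_add_fderiv hh (fun z _ => by ring) hω hb
  simp only [add_apply, smul_apply,
    sub_apply, map_sub, smul_eq_mul] at this
  simp only [bregman, map_sub]
  linarith

/-- Three point inequality for a prox step with two prox terms, where the prox function is also
part of the objective. -/
theorem IsArgmin.bregman_three_point₂ {s : Set G} {φ : G → ℝ} {l : G →L[ℝ] ℝ} {m η p : ℝ}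
    {a a' u b : G} (hs : Convex ℝ s) (hd : DifferentiableOn ℝ φ s)
    (hu : IsArgmin (fun x => m * φ x + l x + η * bregman φ s a x + p * bregman φ s a' x) s u)
    (hb : b ∈ s) :
    m * φ u + l u + η * bregman φ s a u + p * bregman φ s a' u + (m + η + p) * bregman φ s u b ≤
      m * φ b + l b + η * bregman φ s a b + p * bregman φ s a' b := by
  have hbreg : ∀ c, HasFDerivWithinAt (fun z => bregman φ s c z)
      (fderivWithin ℝ φ s u - fderivWithin ℝ φ s c) s u := fun c => by
    refine HasFDerivWithinAt.sub ((hd u hu.1).hasFDerivWithinAt.sub_const _) ?_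
    exact ((fderivWithin ℝ φ s c).hasFDerivAt.comp u
      ((hasFDerivAt_id u).sub_const c)).hasFDerivWithinAt
  have hω : HasFDerivWithinAt
      (fun x => m * φ x + l x + η * bregman φ s a x + p * bregman φ s a' x)
      (m • fderivWithin ℝ φ s u + l + η • (fderivWithin ℝ φ s u - fderivWithin ℝ φ s a)
        + p • (fderivWithin ℝ φ s u - fderivWithin ℝ φ s a')) s u :=
    ((((hd u hu.1).hasFDerivWithinAt.const_mul m).add l.hasFDerivAt.hasFDerivWithinAt).add
      ((hbreg a).const_mul η)).add ((hbreg a').const_mul p)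
  -- The whole objective is treated as the differentiable part. Expanding the Bregman distances then
  -- turns m φ into an extra m-multiple of the distance from u to b, whatever the signs of the
  -- coefficients.
  have := hu.le_add_fderiv (convexOn_const (0 : ℝ) hs) (fun z _ => (zero_add _).symm) hω hb
  simp only [add_apply, smul_apply,
    sub_apply, map_sub, smul_eq_mul] at this
  simp only [bregman, map_sub]
  linarith

end Bregman

namespace BilinearSPP

variable {E : Type u} [NormedAddCommGroup E] [NormedSpace ℝ E]
  {F : Type v} [NormedAddCommGroup F] [NormedSpace ℝ F] (S : BilinearSPP E F)

/-! ### The smooth part and its conjugate -/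

/-- Descent lemma: on the segment, `ft` minus its quadratic upper model has nonpositive derivative
by the Lipschitz bound on the gradient. -/
theorem ft_le_quadratic (g d : E) :
    S.ft (g + d) ≤ S.ft g + fderiv ℝ S.ft g d + S.L / 2 * ‖d‖ ^ 2 := by
  have hline : ∀ t : ℝ, HasDerivAt (fun t : ℝ => S.ft (g + t • d))
      (fderiv ℝ S.ft (g + t • d) d) t := fun t => by
    have h1 : HasDerivAt (fun t : ℝ => g + t • d) d t := by
      simpa using ((hasDerivAt_id t).smul_const d).const_add g
    exact (S.ft_differentiable _).hasFDerivAt.comp_hasDerivAt t h1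
  have hd : ∀ t : ℝ, HasDerivAt
      (fun t : ℝ => S.ft (g + t • d) - t * fderiv ℝ S.ft g d - S.L / 2 * ‖d‖ ^ 2 * t ^ 2)
      (fderiv ℝ S.ft (g + t • d) d - fderiv ℝ S.ft g d - S.L * ‖d‖ ^ 2 * t) t := fun t => by
    have h1 : HasDerivAt (fun t : ℝ => t * fderiv ℝ S.ft g d) (fderiv ℝ S.ft g d) t := by
      simpa using (hasDerivAt_id t).mul_const (fderiv ℝ S.ft g d)
    have h2 : HasDerivAt (fun t : ℝ => S.L / 2 * ‖d‖ ^ 2 * t ^ 2) (S.L * ‖d‖ ^ 2 * t) t := by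
      exact ((hasDerivAt_pow 2 t).const_mul (S.L / 2 * ‖d‖ ^ 2)).congr_deriv (by norm_num; ring)
    exact ((hline t).sub h1).sub h2
  have hanti : AntitoneOn
      (fun t : ℝ => S.ft (g + t • d) - t * fderiv ℝ S.ft g d - S.L / 2 * ‖d‖ ^ 2 * t ^ 2)
      (Set.Icc 0 1) := by
    refine antitoneOn_of_deriv_nonpos (convex_Icc 0 1)
      (fun t _ => (hd t).continuousAt.continuousWithinAt)
      (fun t _ => (hd t).differentiableAt.differentiableWithinAt) fun t ht => ?_
    rw [interior_Icc] at ht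
    rw [(hd t).deriv]
    have h1 := S.ft_lipschitz (g + t • d) g
    have h2 := (le_abs_self _).trans
      ((fderiv ℝ S.ft (g + t • d) - fderiv ℝ S.ft g).le_opNorm d)
    rw [add_sub_cancel_left, norm_smul, Real.norm_of_nonneg ht.1.le] at h1
    have h3 := mul_le_mul_of_nonneg_right h1 (norm_nonneg d)
    rw [sub_apply] at h2
    nlinarith
  have := hanti (Set.left_mem_Icc.2 zero_le_one) (Set.right_mem_Icc.2 zero_le_one) zero_le_one
  simp only [one_smul, zero_smul, add_zero] at this
  linarith

/-- The gradient inequality of convexity, arranged to show that the supremum defining the conjugate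
at the gradient in g is attained at g. -/
theorem fderiv_sub_ft_le (g x : E) :
    fderiv ℝ S.ft g x - S.ft x ≤ fderiv ℝ S.ft g g - S.ft g := by
  have hd := (S.ft_differentiable g).hasFDerivAt.hasFDerivWithinAt.hasDerivWithinAt_segment
    convex_univ (Set.mem_univ g) (Set.mem_univ x)
  have h1 : HasDerivWithinAt (fun t : ℝ => t * (S.ft x - S.ft g)) (S.ft x - S.ft g)
      (Set.Icc 0 1) 0 := by
    simpa using ((hasDerivAt_id (0 : ℝ)).mul_const (S.ft x - S.ft g)).hasDerivWithinAt
  have := (h1.sub hd).nonneg_of_forall_le fun t ht => by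
    have h2 := S.ft_convex.2 (Set.mem_univ g) (Set.mem_univ x) (sub_nonneg.2 ht.2) ht.1 (by ring)
    have h3 : (1 - t) • g + t • x = g + t • (x - g) := by module
    rw [h3] at h2
    simp only [smul_eq_mul] at h2
    simp only [Pi.sub_apply, zero_mul, zero_smul, add_zero, zero_sub]
    linarith
  rw [map_sub] at this
  linarith

theorem fderiv_mem_Y (g : E) : fderiv ℝ S.ft g ∈ S.Y :=
  ⟨fderiv ℝ S.ft g g - S.ft g, by rintro _ ⟨x, rfl⟩; exact S.fderiv_sub_ft_le g x⟩

theorem le_ftConj {y : StrongDual ℝ E} (hy : y ∈ S.Y) (x : E) : y x - S.ft x ≤ S.ftConj y :=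
  le_ciSup (f := fun x => y x - S.ft x) hy x

theorem ftConj_fderiv (g : E) :
    S.ftConj (fderiv ℝ S.ft g) = fderiv ℝ S.ft g g - S.ft g :=
  le_antisymm (ciSup_le (S.fderiv_sub_ft_le g)) (S.le_ftConj (S.fderiv_mem_Y g) g)

theorem ftConj_convexOn : ConvexOn ℝ S.Y S.ftConj := by
  have key : ∀ y ∈ S.Y, ∀ y' ∈ S.Y, ∀ a b : ℝ, 0 ≤ a → 0 ≤ b → a + b = 1 → ∀ x : E,
      (a • y + b • y') x - S.ft x ≤ a * S.ftConj y + b * S.ftConj y' := by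
    intro y hy y' hy' a b ha hb hab x
    have h1 := mul_le_mul_of_nonneg_left (S.le_ftConj hy x) ha
    have h2 := mul_le_mul_of_nonneg_left (S.le_ftConj hy' x) hb
    have h3 : S.ft x = a * S.ft x + b * S.ft x := by rw [← add_mul, hab, one_mul]
    simp only [add_apply, smul_apply, smul_eq_mul]
    linarith
  refine ⟨fun y hy y' hy' a b ha hb hab => ⟨a * S.ftConj y + b * S.ftConj y', ?_⟩,
    fun y hy y' hy' a b ha hb hab => ciSup_le (key y hy y' hy' a b ha hb hab)⟩
  rintro _ ⟨x, rfl⟩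
  exact key y hy y' hy' a b ha hb hab x

/-- Strong convexity of the conjugate, in the form of a bound by all quadratics. -/
theorem sub_quadratic_le_W (g d : E) {y : StrongDual ℝ E} (hy : y ∈ S.Y) :
    (y - fderiv ℝ S.ft g) d - S.L / 2 * ‖d‖ ^ 2 ≤ S.W g (fderiv ℝ S.ft g) y := by
  -- The supremum is tested at g + d. Leaving d free avoids maximizing over d and any question of
  -- attaining the dual norm.
  have h1 := S.le_ftConj hy (g + d)
  have h2 := S.ft_le_quadratic g d
  simp only [W, ftConj_fderiv, sub_apply]
  rw [map_add] at h1
  linarith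

/-- A minimizer of `f^* - ⟨g, ·⟩` is the gradient of `f` at `g`. -/
theorem eq_fderiv_of_forall_le {g : E} {v : StrongDual ℝ E} (hv : v ∈ S.Y)
    (hmin : ∀ y ∈ S.Y, S.ftConj v - v g ≤ S.ftConj y - y g) : v = fderiv ℝ S.ft g := by
  -- Comparison with the gradient at g gives equality in Fenchel's inequality for (g, v), so g
  -- minimizes `ft` - v.
  have h1 := hmin _ (S.fderiv_mem_Y g)
  rw [ftConj_fderiv] at h1
  have hloc : IsLocalMin (fun x => S.ft x - v x) g := by
    refine Filter.Eventually.of_forall fun x => ?_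
    have := S.le_ftConj hv x
    change S.ft g - v g ≤ S.ft x - v x
    linarith
  have := hloc.hasFDerivAt_eq_zero ((S.ft_differentiable g).hasFDerivAt.sub v.hasFDerivAt)
  exact (sub_eq_zero.1 this).symm

theorem half_sq_norm_le_V {a b : E} (ha : a ∈ S.X) (hb : b ∈ S.X) : ‖b - a‖ ^ 2 / 2 ≤ S.V a b :=
  half_sq_norm_le_bregman S.ν_strongConvex S.ν_differentiable ha hb

theorem half_sq_norm_le_U {a b : F} (ha : a ∈ S.Z) (hb : b ∈ S.Z) : ‖b - a‖ ^ 2 / 2 ≤ S.U a b :=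
  half_sq_norm_le_bregman S.ζ_strongConvex S.ζ_differentiable ha hb

theorem V_nonneg {a b : E} (ha : a ∈ S.X) (hb : b ∈ S.X) : 0 ≤ S.V a b :=
  bregman_nonneg S.ν_strongConvex S.ν_differentiable ha hb

theorem U_nonneg {a b : F} (ha : a ∈ S.Z) (hb : b ∈ S.Z) : 0 ≤ S.U a b :=
  bregman_nonneg S.ζ_strongConvex S.ζ_differentiable ha hb

theorem ν_convexOn : ConvexOn ℝ S.X S.ν :=
  S.ν_strongConvex.convexOn (fun _ => by positivity)

end BilinearSPP

/-! ### Conditions on the parameters -/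

/-- The relations between the parameters on which the convergence analysis rests; `a` stands
for `‖A‖`, and `c` is the weight of the prox-function on `Z`. -/
structure PDSParams.Conditions (P : PDSParams) (L μ a c : ℝ) : Prop where
  c_pos : 0 < c
  β_pos : ∀ k, 1 ≤ k → 0 < P.β k
  T_pos : ∀ k, 1 ≤ k → 1 ≤ P.T k
  p_nonneg : ∀ k, 1 ≤ k → 0 ≤ P.p k
  τ_nonneg : ∀ k, 1 ≤ k → 0 ≤ P.τ k
  τ_one : P.τ 1 = 0
  lam_one : P.lam 1 = 0
  β_one_mul_p_one : P.β 1 * P.p 1 = 2 * L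
  τ_pos : ∀ k, 1 ≤ k → 0 < P.τ (k + 1)
  -- The fields `β_mul_lam`, `β_mul_τ_le` and `β_mul_p_le` make the outer sums telescope.
  -- `lam_mul_L_le` absorbs the extrapolation error of a y-step and `L_le` the term left at the end.
  -- `η_eq`, `β_mul_q`, `α_one` and `α_eq` align consecutive inner steps, and `sq_mul_le` absorbs
  -- the coupling through A.
  β_mul_lam : ∀ k, 1 ≤ k → P.β (k + 1) * P.lam (k + 1) = P.β k
  β_mul_τ_le : ∀ k, 1 ≤ k → P.β (k + 1) * P.τ (k + 1) ≤ P.β k * (1 + P.τ k)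
  lam_mul_L_le : ∀ k, 1 ≤ k → P.lam (k + 1) * L ≤ P.τ (k + 1) * P.p k
  L_le : ∀ k, 1 ≤ k → L ≤ P.p k * (1 + P.τ k)
  β_mul_p_le : ∀ k, 1 ≤ k → P.β (k + 1) * (2 * P.p (k + 1)) ≤ P.β k * (2 * P.p k + μ)
  η_eq : ∀ k, 1 ≤ k → ∀ t, P.η k t = (P.p k + μ) * ((t : ℝ) - 1) + P.p k * P.T k
  β_mul_q : ∀ k, 1 ≤ k → ∀ t, P.β k / P.T k * P.q k t = c
  sq_mul_le : ∀ k, 1 ≤ k → ∀ t, 1 ≤ t → P.β k / P.T k * a ^ 2 ≤ c * P.η k t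
  α_one : ∀ k, 1 ≤ k → P.β (k + 1) / P.T (k + 1) * P.α (k + 1) 1 = P.β k / P.T k
  α_eq : ∀ k t, 2 ≤ t → P.α k t = 1

/-- Weighted Young inequality, proved by completing the square after multiplication by 2c so that κ
is never divided by. -/
theorem mul_mul_le_of_sq_le_mul {c κ s m n : ℝ} (hc : 0 < c) (hs : s ^ 2 ≤ c * κ) :
    s * m * n ≤ c / 2 * n ^ 2 + κ / 2 * m ^ 2 := by
  have h1 : 0 ≤ (c * n - s * m) ^ 2 + (c * κ - s ^ 2) * m ^ 2 :=
    add_nonneg (sq_nonneg _) (mul_nonneg (sub_nonneg.2 hs) (sq_nonneg _))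
  have h2 : (c * n - s * m) ^ 2 + (c * κ - s ^ 2) * m ^ 2 =
      2 * c * (c / 2 * n ^ 2 + κ / 2 * m ^ 2 - s * m * n) := by ring
  rw [h2] at h1
  linarith [(mul_nonneg_iff_of_pos_left (by positivity : 0 < 2 * c)).1 h1]

/-! ### One inner iteration -/

namespace BilinearSPP

variable {E : Type u} [NormedAddCommGroup E] [NormedSpace ℝ E]
  {F : Type v} [NormedAddCommGroup F] [NormedSpace ℝ F] (S : BilinearSPP E F)

/-- The gap function of the inner problem with fixed dual variable `y`. -/
noncomputable def innerGap (y : StrongDual ℝ E) (x' : E) (z' : F) (x : E) (z : F) : ℝ :=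
  S.μ * S.ν x' - S.μ * S.ν x + y (x' - x) + S.A x' z - S.A x z' + S.h z' - S.h z

/-- This separates the two estimates: the inner loop controls `innerGap`, the y-step controls the
remainder. -/
theorem gap_eq_innerGap_add (x' x : E) (y' y : StrongDual ℝ E) (z' z : F) :
    S.gap (x', y', z') (x, y, z) =
      S.innerGap y' x' z' x z + (S.ftConj y' - S.ftConj y + (y - y') x') := by
  simp only [gap, innerGap, add_apply, sub_apply, ContinuousLinearMap.flip_apply, map_sub]
  ring

theorem innerGap_sum_le {ι : Type*} (s : Finset ι) (w : ι → ℝ) (hw : ∀ i ∈ s, 0 ≤ w i)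
    (hw1 : ∑ i ∈ s, w i = 1) (y : StrongDual ℝ E) (xs : ι → E) (zs : ι → F)
    (hx : ∀ i ∈ s, xs i ∈ S.X) (hz : ∀ i ∈ s, zs i ∈ S.Z) (x : E) (z : F) :
    S.innerGap y (∑ i ∈ s, w i • xs i) (∑ i ∈ s, w i • zs i) x z ≤
      ∑ i ∈ s, w i * S.innerGap y (xs i) (zs i) x z := by
  have h1 := mul_le_mul_of_nonneg_left (S.ν_convexOn.map_sum_le hw hw1 hx) S.μ_nonneg
  have h2 := S.h_convex.map_sum_le hw hw1 hz
  have h3 : ∑ i ∈ s, w i * S.innerGap y (xs i) (zs i) x z =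
      S.μ * (∑ i ∈ s, w i * S.ν (xs i)) + (∑ i ∈ s, w i * y (xs i))
        + (∑ i ∈ s, w i * S.A (xs i) z) - (∑ i ∈ s, w i * S.A x (zs i))
        + (∑ i ∈ s, w i * S.h (zs i))
        - (∑ i ∈ s, w i) * (S.μ * S.ν x + y x + S.h z) := by
    rw [Finset.mul_sum, Finset.sum_mul, ← Finset.sum_add_distrib, ← Finset.sum_add_distrib,
      ← Finset.sum_sub_distrib, ← Finset.sum_add_distrib, ← Finset.sum_sub_distrib]
    refine Finset.sum_congr rfl fun i _ => ?_
    simp only [innerGap, map_sub]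
    ring
  rw [h3, hw1]
  simp only [innerGap, map_sub, map_sum, map_smul, sum_apply, smul_apply,
    smul_eq_mul] at h1 h2 ⊢
  linarith

/-- One inner iteration: `xp`, `zp` are the previous points, `xt`, `zt` the new ones, `a` is the
prox centre of the outer iteration, and `d` is the direction of extrapolation. -/
theorem inner_step {y : StrongDual ℝ E} {a xp xt d x : E} {zp zt z : F} {α q η p w κ : ℝ}
    (hw : 0 ≤ w) (hη : 0 ≤ η) (hq : 0 < w * q) (hκ : (w * α * ‖S.A‖) ^ 2 ≤ w * q * κ)
    (hxp : xp ∈ S.X) (hzp : zp ∈ S.Z) (hx : x ∈ S.X) (hz : z ∈ S.Z)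
    (hzt : IsArgmin (fun z => S.h z + -(S.A (xp + α • d) z) + q * S.U zp z) S.Z zt)
    (hxt : IsArgmin (fun x => S.μ * S.ν x + (y + S.A.flip zt) x + η * S.V xp x + p * S.V a x)
      S.X xt) :
    w * S.innerGap y xt zt x z ≤
      w * (η * S.V xp x - (S.μ + η + p) * S.V xt x + p * S.V a x - p * S.V a xt)
        + (w * S.A (xt - xp) (z - zt) - w * q * S.U zt z - w * η / 2 * ‖xt - xp‖ ^ 2)
        - (w * α * S.A d (z - zp) - w * q * S.U zp z - κ / 2 * ‖d‖ ^ 2) := by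
  have h1 := mul_le_mul_of_nonneg_left (IsArgmin.bregman_three_point (l := -(S.A (xp + α • d)))
    S.h_convex S.ζ_differentiable hzt hz) hw
  have h2 := mul_le_mul_of_nonneg_left (IsArgmin.bregman_three_point₂ S.X_convex
    S.ν_differentiable hxt hx) hw
  have h3 : w * η * (‖xt - xp‖ ^ 2 / 2) ≤ w * η * S.V xp xt :=
    mul_le_mul_of_nonneg_left (S.half_sq_norm_le_V hxp hxt.1) (mul_nonneg hw hη)
  have h4 : w * q * (‖zt - zp‖ ^ 2 / 2) ≤ w * q * S.U zp zt :=
    mul_le_mul_of_nonneg_left (S.half_sq_norm_le_U hzp hzt.1) hq.le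
  -- Writing z - zt = (z - zp) - (zt - zp) leaves this mixed term. Half of it is paid by the prox
  -- term of the z-step, the other by the κ-term, which the preceding x-step left over. The last two
  -- brackets of the claim thereby become one potential at consecutive steps.
  have h5 : w * α * S.A d (zt - zp) ≤ w * q / 2 * ‖zt - zp‖ ^ 2 + κ / 2 * ‖d‖ ^ 2 := by
    rw [← sq_abs, abs_mul, abs_of_nonneg (norm_nonneg S.A)] at hκ
    refine le_trans ?_ (mul_mul_le_of_sq_le_mul hq hκ)
    refine (le_abs_self _).trans ?_
    rw [abs_mul, mul_assoc |w * α|, mul_assoc |w * α|]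
    exact mul_le_mul_of_nonneg_left (S.A.le_opNorm₂ d _) (abs_nonneg _)
  change w * (S.h zt + _ + q * S.U zp zt + q * S.U zt z) ≤ w * (S.h z + _ + q * S.U zp z) at h1
  change w * (S.μ * S.ν xt + _ + η * S.V xp xt + p * S.V a xt + (S.μ + η + p) * S.V xt x) ≤
    w * (S.μ * S.ν x + _ + η * S.V xp x + p * S.V a x) at h2
  simp only [innerGap, add_apply, neg_apply, smul_apply, smul_eq_mul, map_add, map_smul, map_sub,
    sub_apply, ContinuousLinearMap.flip_apply] at h1 h2 h5 ⊢
  linarith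

end BilinearSPP

/-! ### Telescoping the inner loop -/

namespace PDSIterates

variable {E : Type u} [NormedAddCommGroup E] [NormedSpace ℝ E]
  {F : Type v} [NormedAddCommGroup F] [NormedSpace ℝ F]

/-- The potential after `t ≥ 1` inner iterations of the outer iteration `k`. -/
noncomputable def innerPotential (r : PDSIterates E F) (S : BilinearSPP E F) (P : PDSParams)
    (c : ℝ) (z : F) (k t : ℕ) : ℝ :=
  P.β k / P.T k * S.A (r.xIn k t - r.xIn k (t - 1)) (z - r.zIn k t) - c * S.U (r.zIn k t) z
    - P.β k / P.T k * P.η k t / 2 * ‖r.xIn k t - r.xIn k (t - 1)‖ ^ 2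

/-- The inner potential at the end of the outer iteration `k`. -/
noncomputable def outerPotential (r : PDSIterates E F) (S : BilinearSPP E F) (P : PDSParams)
    (c : ℝ) (z : F) (k : ℕ) : ℝ :=
  if k = 0 then -(c * S.U (r.z 0) z) else r.innerPotential S P c z k (P.T k)

variable {r : PDSIterates E F} {S : BilinearSPP E F} {P : PDSParams} {x₀ : E} {z₀ : F} {N : ℕ}
  {c : ℝ}

theorem IsRun.xIn_mem_of_pos (hr : r.IsRun S P x₀ z₀ N) {k t : ℕ} (hk : 1 ≤ k) (hkN : k ≤ N)
    (ht : 1 ≤ t) (htT : t ≤ P.T k) : r.xIn k t ∈ S.X :=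
  (hr.x_step k hk hkN t ht htT).1

theorem IsRun.zIn_mem_of_pos (hr : r.IsRun S P x₀ z₀ N) {k t : ℕ} (hk : 1 ≤ k) (hkN : k ≤ N)
    (ht : 1 ≤ t) (htT : t ≤ P.T k) : r.zIn k t ∈ S.Z :=
  (hr.z_step k hk hkN t ht htT).1

theorem IsRun.x_mem (hr : r.IsRun S P x₀ z₀ N) (hP : P.Conditions S.L S.μ ‖S.A‖ c) {k : ℕ}
    (hkN : k ≤ N) : r.x k ∈ S.X := by
  rcases Nat.eq_zero_or_pos k with rfl | hk
  · exact hr.x_zero ▸ hr.x_zero_mem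
  · exact hr.x_last k hk hkN ▸ hr.xIn_mem_of_pos hk hkN (hP.T_pos k hk) le_rfl

theorem IsRun.z_mem (hr : r.IsRun S P x₀ z₀ N) (hP : P.Conditions S.L S.μ ‖S.A‖ c) {k : ℕ}
    (hkN : k ≤ N) : r.z k ∈ S.Z := by
  rcases Nat.eq_zero_or_pos k with rfl | hk
  · exact hr.z_zero ▸ hr.z_zero_mem
  · exact hr.z_last k hk hkN ▸ hr.zIn_mem_of_pos hk hkN (hP.T_pos k hk) le_rfl

theorem IsRun.xIn_mem (hr : r.IsRun S P x₀ z₀ N) (hP : P.Conditions S.L S.μ ‖S.A‖ c) {k t : ℕ}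
    (hk : 1 ≤ k) (hkN : k ≤ N) (htT : t ≤ P.T k) : r.xIn k t ∈ S.X := by
  rcases Nat.eq_zero_or_pos t with rfl | ht
  · exact hr.xIn_zero k hk hkN ▸ hr.x_mem hP ((Nat.sub_le _ _).trans hkN)
  · exact hr.xIn_mem_of_pos hk hkN ht htT

theorem IsRun.zIn_mem (hr : r.IsRun S P x₀ z₀ N) (hP : P.Conditions S.L S.μ ‖S.A‖ c) {k t : ℕ}
    (hk : 1 ≤ k) (hkN : k ≤ N) (htT : t ≤ P.T k) : r.zIn k t ∈ S.Z := by
  rcases Nat.eq_zero_or_pos t with rfl | ht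
  · exact hr.zIn_zero k hk hkN ▸ hr.z_mem hP ((Nat.sub_le _ _).trans hkN)
  · exact hr.zIn_mem_of_pos hk hkN ht htT

theorem xHat_eq_sum (r : PDSIterates E F) (P : PDSParams) {k : ℕ} (hk : 1 ≤ k) :
    r.xHat P k = ∑ t ∈ Finset.Icc 1 (P.T k), (P.T k : ℝ)⁻¹ • r.xIn k t := by
  rw [xHat, if_neg (by lia), Finset.smul_sum]

theorem zHat_eq_sum (r : PDSIterates E F) (P : PDSParams) (k : ℕ) :
    r.zHat P k = ∑ t ∈ Finset.Icc 1 (P.T k), (P.T k : ℝ)⁻¹ • r.zIn k t := by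
  rw [zHat, Finset.smul_sum]

theorem sum_inv_T {T : ℕ} (hT : 1 ≤ T) : ∑ _t ∈ Finset.Icc 1 T, (T : ℝ)⁻¹ = 1 := by
  have : (T : ℝ) ≠ 0 := by positivity
  simp [this]

theorem IsRun.xHat_mem (hr : r.IsRun S P x₀ z₀ N) (hP : P.Conditions S.L S.μ ‖S.A‖ c) {k : ℕ}
    (hk : 1 ≤ k) (hkN : k ≤ N) : r.xHat P k ∈ S.X := by
  rw [xHat_eq_sum r P hk]
  exact S.X_convex.sum_mem (fun _ _ => by positivity) (sum_inv_T (hP.T_pos k hk)) fun t ht =>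
    hr.xIn_mem hP hk hkN (Finset.mem_Icc.1 ht).2

theorem IsRun.zHat_mem (hr : r.IsRun S P x₀ z₀ N) (hP : P.Conditions S.L S.μ ‖S.A‖ c) {k : ℕ}
    (hk : 1 ≤ k) (hkN : k ≤ N) : r.zHat P k ∈ S.Z := by
  rw [zHat_eq_sum r P]
  exact S.Z_convex.sum_mem (fun _ _ => by positivity) (sum_inv_T (hP.T_pos k hk)) fun t ht =>
    hr.zIn_mem hP hk hkN (Finset.mem_Icc.1 ht).2

/-- The link between outer iterations: `α_one` rescales the extrapolation so that the potential
entering iteration k + 1 is the one with which iteration k ended. -/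
theorem IsRun.first_inner_step (hr : r.IsRun S P x₀ z₀ N) (hP : P.Conditions S.L S.μ ‖S.A‖ c)
    {k : ℕ} (hk : k + 1 ≤ N) {x : E} (hx : x ∈ S.X) {z : F} (hz : z ∈ S.Z) :
    P.β (k + 1) / P.T (k + 1) * S.innerGap (r.y (k + 1)) (r.xIn (k + 1) 1) (r.zIn (k + 1) 1) x z ≤
      P.β (k + 1) / P.T (k + 1) * (P.η (k + 1) 1 * S.V (r.x k) x
        - (S.μ + P.η (k + 1) 1 + P.p (k + 1)) * S.V (r.xIn (k + 1) 1) x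
        + P.p (k + 1) * S.V (r.x k) x - P.p (k + 1) * S.V (r.x k) (r.xIn (k + 1) 1))
      + r.innerPotential S P c z (k + 1) 1 - r.outerPotential S P c z k := by
  have hk1 : 1 ≤ k + 1 := by lia
  have hT := hP.T_pos (k + 1) hk1
  have hβ := hP.β_pos (k + 1) hk1
  have hp := hP.p_nonneg (k + 1) hk1
  have hq := hP.β_mul_q (k + 1) hk1 1
  have hxs := hr.x_step (k + 1) hk1 hk 1 le_rfl hT
  have hzs := hr.z_step (k + 1) hk1 hk 1 le_rfl hT
  have hx0 := hr.xIn_zero (k + 1) hk1 hk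
  have hz0 := hr.zIn_zero (k + 1) hk1 hk
  have hη : 0 ≤ P.η (k + 1) 1 := by rw [hP.η_eq _ hk1]; simp; positivity
  simp only [Nat.sub_self, Nat.add_sub_cancel] at hxs hzs hx0 hz0
  simp only [uTilde, if_true, Nat.sub_self] at hzs
  rw [hx0] at hxs hzs
  rw [hz0] at hzs
  have hw : 0 ≤ P.β (k + 1) / P.T (k + 1) := by positivity
  rcases Nat.eq_zero_or_pos k with rfl | hk0
  -- Here d = 0 because x_1^{-1} = x_0, so κ only has to satisfy the hypothesis of `inner_step`.
  · have h1 := S.inner_step (d := r.x 0 - r.xInNeg P (0 + 1))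
      (κ := (P.β 1 / P.T 1 * P.α 1 1 * ‖S.A‖) ^ 2 / c) hw hη (hq ▸ hP.c_pos)
      (by rw [hq]; exact (mul_div_cancel₀ _ hP.c_pos.ne').ge) (hr.x_mem hP (by lia))
      (hr.z_mem hP (by lia)) hx hz hzs hxs
    rw [hq] at h1
    simp only [xInNeg, Nat.zero_add, if_true, sub_self, map_zero, zero_apply,
      norm_zero] at h1 hx0 hz0
    simp only [innerPotential, outerPotential, if_true, Nat.zero_add, Nat.sub_self, hx0]
    linarith
  · have hTk := hP.T_pos k hk0
    have hβk := hP.β_pos k hk0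
    have hα := hP.α_one k hk0
    have hsq := hP.sq_mul_le k hk0 (P.T k) hTk
    have h1 := S.inner_step (d := r.x k - r.xInNeg P (k + 1))
      (κ := P.β k / P.T k * P.η k (P.T k)) hw hη (hq ▸ hP.c_pos)
      (by
        rw [hq, hα]
        have := mul_le_mul_of_nonneg_left hsq (by positivity : 0 ≤ P.β k / P.T k)
        linarith) (hr.x_mem hP (by lia)) (hr.z_mem hP (by lia)) hx hz hzs hxs
    rw [hq, hα] at h1
    have hneg : r.xInNeg P (k + 1) = r.xIn k (P.T k - 1) := by
      rw [xInNeg, if_neg (by lia), Nat.add_sub_cancel]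
    rw [hneg] at h1
    simp only [innerPotential, outerPotential, if_neg hk0.ne', Nat.sub_self, hx0,
      ← hr.x_last k hk0 (by lia), ← hr.z_last k hk0 (by lia)]
    linarith

theorem IsRun.inner_step_succ (hr : r.IsRun S P x₀ z₀ N) (hP : P.Conditions S.L S.μ ‖S.A‖ c)
    {k : ℕ} (hk1 : 1 ≤ k) (hk : k ≤ N) {t : ℕ} (ht1 : 1 ≤ t) (ht : t + 1 ≤ P.T k)
    {x : E} (hx : x ∈ S.X) {z : F} (hz : z ∈ S.Z) :
    P.β k / P.T k * S.innerGap (r.y k) (r.xIn k (t + 1)) (r.zIn k (t + 1)) x z ≤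
      P.β k / P.T k * (P.η k (t + 1) * S.V (r.xIn k t) x
        - (S.μ + P.η k (t + 1) + P.p k) * S.V (r.xIn k (t + 1)) x
        + P.p k * S.V (r.x (k - 1)) x - P.p k * S.V (r.x (k - 1)) (r.xIn k (t + 1)))
      + r.innerPotential S P c z k (t + 1) - r.innerPotential S P c z k t := by
  have hT := hP.T_pos k hk1
  have hβ := hP.β_pos k hk1
  have hp := hP.p_nonneg k hk1
  have hq := hP.β_mul_q k hk1 (t + 1)
  have hμ := S.μ_nonneg
  have hxs := hr.x_step k hk1 hk (t + 1) (by lia) ht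
  have hzs := hr.z_step k hk1 hk (t + 1) (by lia) ht
  have hη : 0 ≤ P.η k (t + 1) := by
    rw [hP.η_eq _ hk1]; push_cast; rw [add_sub_cancel_right]; positivity
  simp only [uTilde, if_neg (by lia : ¬ t + 1 = 1), Nat.add_sub_cancel,
    (by lia : t + 1 - 2 = t - 1)] at hxs hzs
  have hw : 0 ≤ P.β k / P.T k := by positivity
  have hα := hP.α_eq k (t + 1) (by lia)
  have hsq := hP.sq_mul_le k hk1 t ht1
  have h1 := S.inner_step (d := r.xIn k t - r.xIn k (t - 1))
    (κ := P.β k / P.T k * P.η k t) hw hη (hq ▸ hP.c_pos)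
    (by
      rw [hq, hα, mul_one]
      have := mul_le_mul_of_nonneg_left hsq hw
      linarith) (hr.xIn_mem hP hk1 hk (by lia)) (hr.zIn_mem hP hk1 hk (by lia)) hx hz hzs hxs
  rw [hq, hα, mul_one] at h1
  simp only [innerPotential, Nat.add_sub_cancel]
  linarith

theorem IsRun.inner_sum_le (hr : r.IsRun S P x₀ z₀ N) (hP : P.Conditions S.L S.μ ‖S.A‖ c)
    {k : ℕ} (hk : k + 1 ≤ N) {x : E} (hx : x ∈ S.X) {z : F} (hz : z ∈ S.Z) {n : ℕ} (hn : 1 ≤ n) :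
    n ≤ P.T (k + 1) →
    P.β (k + 1) / P.T (k + 1) * ∑ t ∈ Finset.Icc 1 n,
        S.innerGap (r.y (k + 1)) (r.xIn (k + 1) t) (r.zIn (k + 1) t) x z ≤
      P.β (k + 1) / P.T (k + 1) * (P.η (k + 1) 1 * S.V (r.x k) x
        - P.η (k + 1) (n + 1) * S.V (r.xIn (k + 1) n) x
        + n * P.p (k + 1) * S.V (r.x k) x
        - P.p (k + 1) * ∑ t ∈ Finset.Icc 1 n, S.V (r.x k) (r.xIn (k + 1) t))
      + r.innerPotential S P c z (k + 1) n - r.outerPotential S P c z k := by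
  -- The linear growth of η in t is designed for this: the coefficient gained at x^t is the one
  -- spent in the next step.
  have hηs : ∀ t : ℕ, S.μ + P.η (k + 1) t + P.p (k + 1) = P.η (k + 1) (t + 1) := fun t => by
    rw [hP.η_eq _ (by lia), hP.η_eq _ (by lia)]; push_cast; ring
  induction n, hn using Nat.le_induction with
  | base =>
    intro _
    have := hr.first_inner_step hP hk hx hz
    rw [hηs] at this
    simp only [Finset.Icc_self, Finset.sum_singleton, Nat.cast_one, one_mul]
    linarith
  | succ n hn ih =>
    intro hT
    have h1 := ih (by lia)
    have h2 := hr.inner_step_succ hP (by lia) hk hn hT hx hz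
    rw [hηs, Nat.add_sub_cancel] at h2
    rw [Finset.sum_Icc_succ_top (by lia), Finset.sum_Icc_succ_top (by lia)]
    push_cast
    linarith

/-- The end values of η are p T and (2p + μ) T, so T cancels after averaging. The terms p V(x_k,
x^t) are kept, through Jensen, as a square of x̂ - x_k for use in the y-step. -/
theorem IsRun.inner_average_le (hr : r.IsRun S P x₀ z₀ N) (hP : P.Conditions S.L S.μ ‖S.A‖ c)
    {k : ℕ} (hk : k + 1 ≤ N) {x : E} (hx : x ∈ S.X) {z : F} (hz : z ∈ S.Z) :
    P.β (k + 1) * S.innerGap (r.y (k + 1)) (r.xHat P (k + 1)) (r.zHat P (k + 1)) x z ≤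
      P.β (k + 1) * (2 * P.p (k + 1) * S.V (r.x k) x
        - (2 * P.p (k + 1) + S.μ) * S.V (r.x (k + 1)) x)
      - P.β (k + 1) * P.p (k + 1) / 2 * ‖r.xHat P (k + 1) - r.x k‖ ^ 2
      + r.outerPotential S P c z (k + 1) - r.outerPotential S P c z k := by
  have hk1 : 1 ≤ k + 1 := by lia
  have hT := hP.T_pos (k + 1) hk1
  have hT0 : (P.T (k + 1) : ℝ) ≠ 0 := by positivity
  have hβ := hP.β_pos (k + 1) hk1
  have hp := hP.p_nonneg (k + 1) hk1
  have hsum := hr.inner_sum_le hP hk hx hz hT le_rfl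
  have hgap := S.innerGap_sum_le (Finset.Icc 1 (P.T (k + 1))) (fun _ => (P.T (k + 1) : ℝ)⁻¹)
    (fun _ _ => by positivity) (sum_inv_T hT) (r.y (k + 1)) (r.xIn (k + 1)) (r.zIn (k + 1))
    (fun t ht => hr.xIn_mem hP hk1 hk (Finset.mem_Icc.1 ht).2)
    (fun t ht => hr.zIn_mem hP hk1 hk (Finset.mem_Icc.1 ht).2) x z
  rw [← xHat_eq_sum r P hk1, ← zHat_eq_sum, ← Finset.mul_sum] at hgap
  have hsq := ((convexOn_dist (r.x k) (convex_univ (𝕜 := ℝ))).pow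
    (fun _ _ => dist_nonneg) 2).map_sum_le (t := Finset.Icc 1 (P.T (k + 1)))
    (w := fun _ => (P.T (k + 1) : ℝ)⁻¹) (p := r.xIn (k + 1))
    (fun _ _ => by positivity) (sum_inv_T hT) (fun _ _ => Set.mem_univ _)
  rw [← xHat_eq_sum r P hk1] at hsq
  simp only [Pi.pow_apply, dist_eq_norm, smul_eq_mul] at hsq
  rw [← Finset.mul_sum] at hsq
  have hV : ∑ t ∈ Finset.Icc 1 (P.T (k + 1)), ‖r.xIn (k + 1) t - r.x k‖ ^ 2 ≤
      2 * ∑ t ∈ Finset.Icc 1 (P.T (k + 1)), S.V (r.x k) (r.xIn (k + 1) t) := by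
    rw [Finset.mul_sum]
    refine Finset.sum_le_sum fun t ht => ?_
    have := S.half_sq_norm_le_V (hr.x_mem hP (by lia : k ≤ N))
      (hr.xIn_mem hP hk1 hk (Finset.mem_Icc.1 ht).2)
    linarith
  have h1 := mul_le_mul_of_nonneg_left hgap hβ.le
  have h2 := mul_le_mul_of_nonneg_left (hsq.trans
    (mul_le_mul_of_nonneg_left hV (by positivity)))
    (by positivity : 0 ≤ P.β (k + 1) * P.p (k + 1) / 2)
  rw [outerPotential, if_neg (by lia)]
  rw [← hr.x_last _ hk1 hk, hP.η_eq _ hk1, hP.η_eq _ hk1, div_mul_eq_mul_div,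
    div_mul_eq_mul_div] at hsum
  push_cast at hsum
  set s₁ := ∑ t ∈ Finset.Icc 1 (P.T (k + 1)), S.V (r.x k) (r.xIn (k + 1) t)
  set s₂ := ∑ t ∈ Finset.Icc 1 (P.T (k + 1)),
    S.innerGap (r.y (k + 1)) (r.xIn (k + 1) t) (r.zIn (k + 1) t) x z
  set T : ℝ := (P.T (k + 1) : ℝ)
  have h3 : P.β (k + 1) * ((P.p (k + 1) + S.μ) * (1 - 1) * S.V (r.x k) x
      + P.p (k + 1) * T * S.V (r.x k) x
      - ((P.p (k + 1) + S.μ) * (T + 1 - 1) + P.p (k + 1) * T) * S.V (r.x (k + 1)) x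
        + T * P.p (k + 1) * S.V (r.x k) x - P.p (k + 1) * s₁) / T =
      P.β (k + 1) * (2 * P.p (k + 1) * S.V (r.x k) x
        - (2 * P.p (k + 1) + S.μ) * S.V (r.x (k + 1)) x)
        - P.β (k + 1) * P.p (k + 1) / 2 * (T⁻¹ * (2 * s₁)) := by
    field_simp
    ring
  have h4 : P.β (k + 1) * s₂ / T = P.β (k + 1) * (T⁻¹ * s₂) := by ring
  rw [h4] at hsum
  have h5 : ((P.p (k + 1) + S.μ) * (1 - 1) + P.p (k + 1) * T) * S.V (r.x k) x =
    (P.p (k + 1) + S.μ) * (1 - 1) * S.V (r.x k) x + P.p (k + 1) * T * S.V (r.x k) x := by ring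
  rw [h5, h3] at hsum
  linarith

end PDSIterates

/-! ### The y-steps and the outer telescoping sum -/

namespace PDSIterates

variable {E : Type u} [NormedAddCommGroup E] [NormedSpace ℝ E]
  {F : Type v} [NormedAddCommGroup F] [NormedSpace ℝ F]
  {r : PDSIterates E F} {S : BilinearSPP E F} {P : PDSParams} {x₀ : E} {z₀ : F} {N : ℕ} {c : ℝ}

/-- Since x̃_k = (1 + τ_k) g_k - τ_k g_{k-1}, the objective of the y-step is, up to a constant, 1 +
τ_k times the conjugate minus the pairing with g_k. -/
theorem IsRun.y_eq_fderiv (hr : r.IsRun S P x₀ z₀ N) (hP : P.Conditions S.L S.μ ‖S.A‖ c) {k : ℕ}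
    (hk : 1 ≤ k) (hkN : k ≤ N) : r.y k = fderiv ℝ S.ft (r.g k) := by
  have hτ := hP.τ_nonneg k hk
  obtain ⟨hy, hmin⟩ := hr.y_step k hk hkN
  refine S.eq_fderiv_of_forall_le hy fun y hy' => ?_
  have h1 := hmin y hy'
  have hg : r.xTilde P k = (1 + P.τ k) • r.g k - P.τ k • r.g (k - 1) := by
    rw [hr.g_step k hk hkN, smul_smul, mul_inv_cancel₀ (by positivity), one_smul,
      add_sub_cancel_right]
  rw [hg] at h1
  simp only [BilinearSPP.W, map_sub, map_smul, smul_eq_mul, sub_apply] at h1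
  have h2 : 0 ≤ (1 + P.τ k) * ((S.ftConj y - y (r.g k)) - (S.ftConj (r.y k) - r.y k (r.g k))) := by
    linarith
  linarith [(mul_nonneg_iff_of_pos_left (by positivity)).1 h2]

/-- The potential of the dual variable `y` after the outer iteration `k`. -/
noncomputable def dualPotential (r : PDSIterates E F) (S : BilinearSPP E F) (P : PDSParams)
    (y : StrongDual ℝ E) (k : ℕ) : ℝ :=
  if k = 0 then 0 else
    P.β k * (y - r.y k) (r.xHat P k - r.x (k - 1)) - P.β k * (1 + P.τ k) * S.W (r.g k) (r.y k) y
      - P.β k * P.p k / 2 * ‖r.xHat P k - r.x (k - 1)‖ ^ 2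

/-- The identity behind the `y`-step. -/
theorem IsRun.y_step_eq (hr : r.IsRun S P x₀ z₀ N) (hP : P.Conditions S.L S.μ ‖S.A‖ c) {k : ℕ}
    (hk : 1 ≤ k) (hkN : k ≤ N) (y : StrongDual ℝ E) :
    S.ftConj (r.y k) - S.ftConj y + (y - r.y k) (r.xTilde P k) =
      P.τ k * S.W (r.g (k - 1)) (r.y (k - 1)) y
        - P.τ k * S.W (r.g (k - 1)) (r.y (k - 1)) (r.y k)
        - (1 + P.τ k) * S.W (r.g k) (r.y k) y := by
  have hτ := hP.τ_nonneg k hk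
  have hg : r.xTilde P k = (1 + P.τ k) • r.g k - P.τ k • r.g (k - 1) := by
    rw [hr.g_step k hk hkN, smul_smul, mul_inv_cancel₀ (by positivity), one_smul,
      add_sub_cancel_right]
  rw [hg]
  simp only [BilinearSPP.W, map_sub, map_smul, smul_eq_mul, sub_apply]
  ring

theorem IsRun.dual_step_one (hr : r.IsRun S P x₀ z₀ N) (hP : P.Conditions S.L S.μ ‖S.A‖ c)
    (hN : 1 ≤ N) (y : StrongDual ℝ E) :
    P.β 1 * (S.ftConj (r.y 1) - S.ftConj y + (y - r.y 1) (r.xHat P 1))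
      - P.β 1 * P.p 1 / 2 * ‖r.xHat P 1 - r.x 0‖ ^ 2 =
      r.dualPotential S P y 1 - r.dualPotential S P y 0 := by
  have h1 := hr.y_step_eq hP le_rfl hN y
  have h2 : r.xTilde P 1 = r.x 0 := by simp [xTilde, hP.lam_one]
  rw [h2, hP.τ_one] at h1
  simp only [dualPotential, if_true, if_neg one_ne_zero, hP.τ_one, Nat.sub_self]
  have h3 : S.ftConj (r.y 1) - S.ftConj y =
    -(y - r.y 1) (r.x 0) - S.W (r.g 1) (r.y 1) y := by linarith
  rw [h3, map_sub]
  ring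

/-- With d = x̂_k - x_{k-1}, the error λ⟨y - y_{k+1}, d⟩ splits into λ⟨y - y_k, d⟩, which telescopes
because β_{k+1} λ_{k+1} = β_k, and a mixed term bounded by W and the reserve of iteration k. -/
theorem IsRun.dual_step_succ (hr : r.IsRun S P x₀ z₀ N) (hP : P.Conditions S.L S.μ ‖S.A‖ c)
    {k : ℕ} (hk1 : 1 ≤ k) (hk : k + 1 ≤ N) {y : StrongDual ℝ E} (hy : y ∈ S.Y) :
    P.β (k + 1) * (S.ftConj (r.y (k + 1)) - S.ftConj y + (y - r.y (k + 1)) (r.xHat P (k + 1)))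
      - P.β (k + 1) * P.p (k + 1) / 2 * ‖r.xHat P (k + 1) - r.x k‖ ^ 2 ≤
      r.dualPotential S P y (k + 1) - r.dualPotential S P y k := by
  have hstep := hr.y_step_eq hP (by lia : 1 ≤ k + 1) hk y
  set d := r.xHat P k - r.x (k - 1) with hd
  have hxt : r.xTilde P (k + 1) = r.x k + P.lam (k + 1) • d := by
    simp only [xTilde, if_neg (by lia : ¬ k + 1 = 1), Nat.add_sub_cancel, hd,
      (by lia : k + 1 - 2 = k - 1)]
  have hτ := hP.τ_pos k hk1
  have hβ := hP.β_pos (k + 1) (by lia)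
  have hβk := hP.β_pos k hk1
  have hlam := hP.β_mul_lam k hk1
  have hlam0 : 0 ≤ P.lam (k + 1) := by
    by_contra hneg
    have := mul_neg_of_pos_of_neg hβ (not_le.1 hneg)
    linarith
  have hyk := hr.y_eq_fderiv hP hk1 (by lia)
  have hWnn : 0 ≤ S.W (r.g k) (r.y k) y := by
    have := S.sub_quadratic_le_W (r.g k) 0 hy
    rw [← hyk] at this
    simpa using this
  have hW : P.lam (k + 1) * (r.y (k + 1) - r.y k) d - P.lam (k + 1) * P.p k / 2 * ‖d‖ ^ 2 ≤
      P.τ (k + 1) * S.W (r.g k) (r.y k) (r.y (k + 1)) := by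
    -- The scale λ/τ makes the linear term exactly λ⟨y_{k+1} - y_k, d⟩; the quadratic cost λ²L/τ is
    -- then at most λ p_k.
    have h1 := mul_le_mul_of_nonneg_left (S.sub_quadratic_le_W (r.g k)
      ((P.lam (k + 1) / P.τ (k + 1)) • d) (hr.y_step (k + 1) (by lia) hk).1) hτ.le
    rw [← hyk, map_smul, norm_smul, smul_eq_mul, mul_pow, Real.norm_eq_abs, sq_abs] at h1
    have h2 : P.τ (k + 1) * (P.lam (k + 1) / P.τ (k + 1) * (r.y (k + 1) - r.y k) d
        - S.L / 2 * ((P.lam (k + 1) / P.τ (k + 1)) ^ 2 * ‖d‖ ^ 2)) =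
        P.lam (k + 1) * (r.y (k + 1) - r.y k) d
        - P.lam (k + 1) * (P.lam (k + 1) * S.L / P.τ (k + 1)) / 2 * ‖d‖ ^ 2 := by
      field_simp
    have h3 : P.lam (k + 1) * S.L / P.τ (k + 1) ≤ P.p k := by
      rw [div_le_iff₀ hτ, mul_comm (P.p k)]
      exact hP.lam_mul_L_le k hk1
    have h4 : P.lam (k + 1) * (P.lam (k + 1) * S.L / P.τ (k + 1)) / 2 * ‖d‖ ^ 2 ≤
        P.lam (k + 1) * P.p k / 2 * ‖d‖ ^ 2 := by gcongr
    linarith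
  have h5 := mul_le_mul_of_nonneg_right (hP.β_mul_τ_le k hk1) hWnn
  have h6 := mul_le_mul_of_nonneg_left hW hβ.le
  rw [hxt, Nat.add_sub_cancel] at hstep
  simp only [dualPotential, if_neg (by lia : ¬ k + 1 = 0), if_neg (by lia : ¬ k = 0),
    Nat.add_sub_cancel, ← hd]
  have h7 : S.ftConj (r.y (k + 1)) - S.ftConj y =
      P.τ (k + 1) * S.W (r.g k) (r.y k) y - P.τ (k + 1) * S.W (r.g k) (r.y k) (r.y (k + 1))
        - (1 + P.τ (k + 1)) * S.W (r.g (k + 1)) (r.y (k + 1)) y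
        - (y - r.y (k + 1)) (r.x k + P.lam (k + 1) • d) := by linarith
  rw [h7, ← hlam]
  rw [← hlam] at h5
  simp only [map_add, map_sub, map_smul, smul_eq_mul, sub_apply] at h6 ⊢
  linarith

theorem IsRun.dualPotential_nonpos (hr : r.IsRun S P x₀ z₀ N)
    (hP : P.Conditions S.L S.μ ‖S.A‖ c) {k : ℕ} (hk : k ≤ N) {y : StrongDual ℝ E} (hy : y ∈ S.Y) :
    r.dualPotential S P y k ≤ 0 := by
  rcases Nat.eq_zero_or_pos k with rfl | hk1
  · simp [dualPotential]
  have hβ := hP.β_pos k hk1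
  have hτ := hP.τ_nonneg k hk1
  have hL := S.L_pos
  set d := r.xHat P k - r.x (k - 1) with hd
  have h1 := S.sub_quadratic_le_W (r.g k) ((1 + P.τ k)⁻¹ • d) hy
  rw [← hr.y_eq_fderiv hP hk1 hk, map_smul, norm_smul, smul_eq_mul, mul_pow, Real.norm_eq_abs,
    sq_abs] at h1
  have h2 := mul_le_mul_of_nonneg_left h1 (by positivity : 0 ≤ P.β k * (1 + P.τ k))
  have h3 : P.β k * (1 + P.τ k) * ((1 + P.τ k)⁻¹ * (y - r.y k) d
      - S.L / 2 * ((1 + P.τ k)⁻¹ ^ 2 * ‖d‖ ^ 2)) =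
      P.β k * (y - r.y k) d - P.β k * (S.L / (1 + P.τ k)) / 2 * ‖d‖ ^ 2 := by
    field_simp
  have h4 : S.L / (1 + P.τ k) ≤ P.p k := (div_le_iff₀ (by positivity)).2 (hP.L_le k hk1)
  have h5 : P.β k * (S.L / (1 + P.τ k)) / 2 * ‖d‖ ^ 2 ≤ P.β k * P.p k / 2 * ‖d‖ ^ 2 := by gcongr
  simp only [dualPotential, if_neg hk1.ne', ← hd]
  linarith

/-- The coupling left after the last inner step is absorbed by Young's inequality as in
`inner_step`, with U(z_k, z) as the payer. -/
theorem IsRun.outerPotential_nonpos (hr : r.IsRun S P x₀ z₀ N)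
    (hP : P.Conditions S.L S.μ ‖S.A‖ c) {k : ℕ} (hk : k ≤ N) {z : F} (hz : z ∈ S.Z) :
    r.outerPotential S P c z k ≤ 0 := by
  rcases Nat.eq_zero_or_pos k with rfl | hk1
  · have := mul_nonneg hP.c_pos.le (S.U_nonneg (hr.z_mem hP hk) hz)
    simp only [outerPotential, if_true]
    linarith
  have hT := hP.T_pos k hk1
  have hβ := hP.β_pos k hk1
  have hw : 0 ≤ P.β k / P.T k := by positivity
  rw [outerPotential, if_neg hk1.ne', innerPotential]
  set d := r.xIn k (P.T k) - r.xIn k (P.T k - 1)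
  set e := z - r.zIn k (P.T k)
  have h1 : P.β k / P.T k * S.A d e ≤ P.β k / P.T k * ‖S.A‖ * ‖d‖ * ‖e‖ := by
    rw [mul_assoc, mul_assoc, ← mul_assoc ‖S.A‖]
    exact mul_le_mul_of_nonneg_left ((le_abs_self _).trans (S.A.le_opNorm₂ d e)) hw
  have h2 : (P.β k / P.T k * ‖S.A‖) ^ 2 ≤ c * (P.β k / P.T k * P.η k (P.T k)) := by
    have := mul_le_mul_of_nonneg_left (hP.sq_mul_le k hk1 _ hT) hw
    linarith
  have h3 := mul_mul_le_of_sq_le_mul (m := ‖d‖) (n := ‖e‖) hP.c_pos h2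
  have h4 := mul_le_mul_of_nonneg_left (S.half_sq_norm_le_U (hr.zIn_mem hP hk1 hk le_rfl) hz)
    hP.c_pos.le
  linarith

/-- The squares of x̂ - x in the inner and dual estimates cancel, leaving only telescoping terms.
The initial coefficient 4L is 2 β_1 p_1. -/
theorem IsRun.sum_gap_le_potential (hr : r.IsRun S P x₀ z₀ N)
    (hP : P.Conditions S.L S.μ ‖S.A‖ c) {x : E} (hx : x ∈ S.X) {y : StrongDual ℝ E} (hy : y ∈ S.Y)
    {z : F} (hz : z ∈ S.Z) (n : ℕ) (hn : n + 1 ≤ N) :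
    ∑ k ∈ Finset.Icc 1 (n + 1),
        P.β k * S.gap (r.xHat P k, r.y k, r.zHat P k) (x, y, z) ≤
      4 * S.L * S.V x₀ x - P.β (n + 1) * (2 * P.p (n + 1) + S.μ) * S.V (r.x (n + 1)) x
        + r.outerPotential S P c z (n + 1) + c * S.U z₀ z + r.dualPotential S P y (n + 1) := by
  induction n with
  | zero =>
    have h1 := hr.inner_average_le hP hn hx hz
    have h2 := hr.dual_step_one hP hn y
    have h3 := hP.β_one_mul_p_one
    have h4 : P.β 1 * (2 * P.p 1 * S.V x₀ x) = 4 * S.L * S.V x₀ x := by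
      rw [← mul_assoc, mul_left_comm, h3]; ring
    simp only [Nat.zero_add, Finset.Icc_self, Finset.sum_singleton, S.gap_eq_innerGap_add,
      hr.x_zero] at h1 h2 ⊢
    have h5 : r.outerPotential S P c z 0 = -(c * S.U z₀ z) := by
      simp [outerPotential, hr.z_zero]
    have h6 : r.dualPotential S P y 0 = 0 := by simp [dualPotential]
    rw [h5] at h1
    rw [h6] at h2
    linarith
  | succ n ih =>
    have h1 := hr.inner_average_le hP hn hx hz
    have h2 := hr.dual_step_succ hP (by lia) hn hy
    have h3 := mul_le_mul_of_nonneg_right (hP.β_mul_p_le (n + 1) (by lia))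
      (S.V_nonneg (hr.x_mem hP (by lia : n + 1 ≤ N)) hx)
    rw [Finset.sum_Icc_succ_top (by lia), S.gap_eq_innerGap_add]
    have := ih (by lia)
    linarith

theorem IsRun.sum_gap_le (hr : r.IsRun S P x₀ z₀ N)
    (hP : P.Conditions S.L S.μ ‖S.A‖ c) (hN : 1 ≤ N) {x : E} (hx : x ∈ S.X) {y : StrongDual ℝ E}
    (hy : y ∈ S.Y) {z : F} (hz : z ∈ S.Z) :
    ∑ k ∈ Finset.Icc 1 N, P.β k * S.gap (r.xHat P k, r.y k, r.zHat P k) (x, y, z) ≤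
      c * S.U z₀ z + 4 * S.L * S.V x₀ x := by
  obtain ⟨n, rfl⟩ : ∃ n, N = n + 1 := ⟨N - 1, by lia⟩
  have h1 := hr.sum_gap_le_potential hP hx hy hz n le_rfl
  have h2 := hr.dualPotential_nonpos hP le_rfl hy
  have h3 := hr.outerPotential_nonpos hP le_rfl hz
  have hβ := hP.β_pos (n + 1) (by lia)
  have hp := hP.p_nonneg (n + 1) (by lia)
  have hμ := S.μ_nonneg
  have h4 : 0 ≤ P.β (n + 1) * (2 * P.p (n + 1) + S.μ) * S.V (r.x (n + 1)) x :=
    mul_nonneg (by positivity) (S.V_nonneg (hr.x_mem hP le_rfl) hx)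
  linarith

end PDSIterates

/-! ### Convexity of the gap and the averaged output -/

namespace BilinearSPP

variable {E : Type u} [NormedAddCommGroup E] [NormedSpace ℝ E]
  {F : Type v} [NormedAddCommGroup F] [NormedSpace ℝ F] (S : BilinearSPP E F)

theorem feasible_convex : Convex ℝ S.feasible :=
  S.X_convex.prod (S.ftConj_convexOn.1.prod S.Z_convex)

/-- Every coupling in Q pairs a component of w' with one of w, so no product of moving variables
spoils joint convexity. -/
theorem gap_convexOn (w : E × StrongDual ℝ E × F) :
    ConvexOn ℝ S.feasible (fun w' => S.gap w' w) := by
  refine ⟨S.feasible_convex, ?_⟩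
  rintro ⟨x₁, y₁, z₁⟩ ⟨hx₁, hy₁, hz₁⟩ ⟨x₂, y₂, z₂⟩ ⟨hx₂, hy₂, hz₂⟩ a b ha hb hab
  obtain ⟨x, y, z⟩ := w
  have h1 := mul_le_mul_of_nonneg_left (S.ν_convexOn.2 hx₁ hx₂ ha hb hab) S.μ_nonneg
  have h2 := S.ftConj_convexOn.2 hy₁ hy₂ ha hb hab
  have h3 := S.h_convex.2 hz₁ hz₂ ha hb hab
  have h4 : S.ftConj y + S.h z + S.μ * S.ν x =
      a * (S.ftConj y + S.h z + S.μ * S.ν x) + b * (S.ftConj y + S.h z + S.μ * S.ν x) := by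
    rw [← add_mul, hab, one_mul]
  simp only [gap, Prod.smul_mk, map_add, map_smul, add_apply, smul_apply,
    smul_eq_mul, ContinuousLinearMap.flip_apply] at h1 h2 h3 ⊢
  linarith

end BilinearSPP

namespace PDSIterates

variable {E : Type u} [NormedAddCommGroup E] [NormedSpace ℝ E]
  {F : Type v} [NormedAddCommGroup F] [NormedSpace ℝ F]
  {r : PDSIterates E F} {S : BilinearSPP E F} {P : PDSParams} {x₀ : E} {z₀ : F} {N : ℕ} {c : ℝ}

theorem IsRun.average_mem_feasible (hr : r.IsRun S P x₀ z₀ N)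
    (hP : P.Conditions S.L S.μ ‖S.A‖ c) {k : ℕ} (hk : k ∈ Finset.Icc 1 N) :
    (r.xHat P k, r.y k, r.zHat P k) ∈ S.feasible :=
  have h := Finset.mem_Icc.1 hk
  ⟨hr.xHat_mem hP h.1 h.2, (hr.y_step k h.1 h.2).1, hr.zHat_mem hP h.1 h.2⟩

theorem sum_β_pos (hP : P.Conditions S.L S.μ ‖S.A‖ c) (hN : 1 ≤ N) :
    0 < ∑ k ∈ Finset.Icc 1 N, P.β k :=
  Finset.sum_pos (fun k hk => hP.β_pos k (Finset.mem_Icc.1 hk).1) ⟨1, by simp [hN]⟩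

theorem IsRun.output_mem_feasible (hr : r.IsRun S P x₀ z₀ N)
    (hP : P.Conditions S.L S.μ ‖S.A‖ c) (hN : 1 ≤ N) : r.output P N ∈ S.feasible :=
  S.feasible_convex.centerMass_mem (fun k hk => (hP.β_pos k (Finset.mem_Icc.1 hk).1).le)
    (sum_β_pos hP hN) fun _ hk => hr.average_mem_feasible hP hk

theorem IsRun.gap_output_le (hr : r.IsRun S P x₀ z₀ N)
    (hP : P.Conditions S.L S.μ ‖S.A‖ c) (hN : 1 ≤ N) {x : E} (hx : x ∈ S.X) {y : StrongDual ℝ E}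
    (hy : y ∈ S.Y) {z : F} (hz : z ∈ S.Z) :
    S.gap (r.output P N) (x, y, z) ≤
      (∑ k ∈ Finset.Icc 1 N, P.β k)⁻¹ * (c * S.U z₀ z + 4 * S.L * S.V x₀ x) := by
  -- `output` is by definition the centre of mass with weights β_k.
  have h1 := (S.gap_convexOn (x, y, z)).map_centerMass_le
    (fun k hk => (hP.β_pos k (Finset.mem_Icc.1 hk).1).le)
    (sum_β_pos hP hN) fun _ hk => hr.average_mem_feasible hP hk
  exact h1.trans (mul_le_mul_of_nonneg_left (hr.sum_gap_le hP hN hx hy hz)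
    (inv_nonneg.2 (sum_β_pos hP hN).le))

end PDSIterates

/-! ### The parameters -/

section Parameters

variable {L μ R a : ℝ}

theorem PDSEarly.of_succ {k : ℕ} (h : PDSEarly L μ (k + 1)) : PDSEarly L μ k :=
  h.imp_right fun h => by lia

theorem pdsTau_pos (hL : 0 < L) (hμ : 0 < μ) : 0 < pdsTau L μ :=
  Real.sqrt_pos.2 (by positivity)

theorem pdsTau_sq_mul (hL : 0 < L) (hμ : 0 < μ) : pdsTau L μ ^ 2 * μ = 2 * L := by
  rw [pdsTau, Real.sq_sqrt (by positivity)]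
  field_simp

theorem pdsTau_nonneg (L μ : ℝ) : 0 ≤ pdsTau L μ := Real.sqrt_nonneg _

theorem le_pdsDelta (L μ : ℝ) : 2 * pdsTau L μ + 1 ≤ pdsDelta L μ := Nat.le_ceil _

theorem pdsDelta_le (L μ : ℝ) : (pdsDelta L μ : ℝ) ≤ 2 * pdsTau L μ + 2 := by
  have h0 := pdsTau_nonneg L μ
  have := Nat.ceil_lt_add_one (by positivity : 0 ≤ 2 * pdsTau L μ + 1)
  rw [pdsDelta]
  linarith

theorem one_le_pdsDelta (L μ : ℝ) : 1 ≤ pdsDelta L μ := by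
  have h0 := pdsTau_nonneg L μ
  have h1 := le_pdsDelta L μ
  have : (1 : ℝ) ≤ pdsDelta L μ := by linarith
  exact_mod_cast this

theorem pdsEarly_one (L μ : ℝ) : PDSEarly L μ 1 := Or.inr (one_le_pdsDelta L μ)

theorem pdsLam_pos (hL : 0 < L) (hμ : 0 < μ) : 0 < pdsLam L μ := by
  have := pdsTau_pos hL hμ
  unfold pdsLam
  positivity

theorem pdsLam_lt_one (L μ : ℝ) : pdsLam L μ < 1 := by
  have := pdsTau_nonneg L μ
  rw [pdsLam, div_lt_one (by positivity)]
  linarith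

theorem pdsLam_mul (L μ : ℝ) : pdsLam L μ * (1 + pdsTau L μ) = pdsTau L μ := by
  have := pdsTau_nonneg L μ
  rw [pdsLam, div_mul_cancel₀ _ (by positivity)]

theorem not_pdsEarly {k : ℕ} (hμ0 : 0 ≤ μ) (h : ¬ PDSEarly L μ k) :
    0 < μ ∧ pdsDelta L μ < k := by
  rw [PDSEarly, not_or, not_le] at h
  exact ⟨hμ0.lt_of_ne' h.1, h.2⟩

theorem pdsBeta_early {k : ℕ} (h : PDSEarly L μ k) : pdsBeta L μ k = k := if_pos h

theorem pdsP_early {k : ℕ} (h : PDSEarly L μ k) : pdsP L μ k = 2 * L / k := if_pos h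

theorem pdsP_late {k : ℕ} (h : ¬ PDSEarly L μ k) : pdsP L μ k = L / (1 + pdsTau L μ) := if_neg h

theorem pdsT_early {k : ℕ} (h : PDSEarly L μ k) : pdsT L μ R a k = ⌈(k : ℝ) * R * a / L⌉₊ :=
  if_pos h

theorem pdsBeta_late {k : ℕ} (h : ¬ PDSEarly L μ k) :
    pdsBeta L μ k = pdsDelta L μ * ((pdsLam L μ)⁻¹) ^ (k - pdsDelta L μ) := by
  have hk : pdsDelta L μ ≤ k := by
    rw [PDSEarly, not_or, not_le] at h
    exact h.2.le
  rw [pdsBeta, if_neg h, ← Nat.cast_sub hk, zpow_neg, zpow_natCast, inv_pow]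

/-- The real power becomes a natural power of √(1/λ), so that the late T_k are rounded terms of a
geometric progression. -/
theorem pdsT_late (hL : 0 < L) (hμ : 0 < μ) {k : ℕ} (h : ¬ PDSEarly L μ k) :
    pdsT L μ R a k =
      ⌈2 * (1 + pdsTau L μ) * R * a / L * √((pdsLam L μ)⁻¹) ^ (k - pdsDelta L μ)⌉₊ := by
  have hk := (not_pdsEarly hμ.le h).2.le
  have hlam := pdsLam_pos hL hμ
  rw [pdsT, if_neg h]
  congr 1
  rw [← Nat.cast_sub hk, Real.sqrt_inv, div_mul_eq_div_div, inv_pow, ← div_eq_mul_inv]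
  congr 1
  rw [Real.sqrt_eq_rpow, ← Real.rpow_natCast, ← Real.rpow_mul hlam.le]
  congr 1
  ring

theorem pdsBeta_pos (hL : 0 < L) (hμ : 0 ≤ μ) {k : ℕ} (hk : 1 ≤ k) : 0 < pdsBeta L μ k := by
  by_cases h : PDSEarly L μ k
  · rw [pdsBeta_early h]
    positivity
  · have hlam := pdsLam_pos hL (not_pdsEarly hμ h).1
    have := one_le_pdsDelta L μ
    rw [pdsBeta_late h]
    positivity

/-- The first late weight agrees with the formula that holds from there on. -/
theorem pdsBeta_succ_mul_lam (hL : 0 < L) (hμ : 0 ≤ μ) {k : ℕ} (h : ¬ PDSEarly L μ (k + 1)) :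
    pdsBeta L μ (k + 1) * pdsLam L μ = pdsBeta L μ k := by
  obtain ⟨hμ', hk⟩ := not_pdsEarly hμ h
  have hlam := (pdsLam_pos hL hμ').ne'
  rw [pdsBeta_late h]
  by_cases h' : PDSEarly L μ k
  · have : k = pdsDelta L μ := by
      rcases h' with h' | h'
      · exact absurd h' hμ'.ne'
      · lia
    rw [pdsBeta_early h', this]
    simp [hlam]
  · have hk' := (not_pdsEarly hμ h').2
    rw [pdsBeta_late h', (by lia : k + 1 - pdsDelta L μ = k - pdsDelta L μ + 1), pow_succ]
    field_simp

theorem pdsT_pos (hL : 0 < L) (hμ : 0 ≤ μ) (hR : 0 < R) (ha : 0 < a) {k : ℕ} (hk : 1 ≤ k) :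
    1 ≤ pdsT L μ R a k := by
  by_cases h : PDSEarly L μ k
  · rw [pdsT_early h]
    exact Nat.one_le_ceil_iff.2 (by positivity)
  · have hμ' := (not_pdsEarly hμ h).1
    have hlam := pdsLam_pos hL hμ'
    have hτ := pdsTau_nonneg L μ
    rw [pdsT_late hL hμ' h]
    exact Nat.one_le_ceil_iff.2 (by positivity)

theorem pdsP_pos (hL : 0 < L) {k : ℕ} (hk : 1 ≤ k) : 0 < pdsP L μ k := by
  have hτ := pdsTau_nonneg L μ
  by_cases h : PDSEarly L μ k
  · rw [pdsP_early h]
    positivity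
  · rw [pdsP_late h]
    positivity

/-- This is what dictates T_k. Before rounding up, the early case is an equality, and so is the late
one once Δ is replaced by its bound 2τ + 2. -/
theorem pdsBeta_mul_sq_le (hL : 0 < L) (hμ : 0 ≤ μ) (hR : 0 < R) (ha : 0 < a) {k : ℕ}
    (hk : 1 ≤ k) :
    pdsBeta L μ k * a ^ 2 ≤ L / (2 * R ^ 2) * (pdsP L μ k * (pdsT L μ R a k : ℝ) ^ 2) := by
  by_cases h : PDSEarly L μ k
  · have h1 : (k : ℝ) * R * a / L ≤ pdsT L μ R a k := by
      rw [pdsT_early h]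
      exact Nat.le_ceil _
    rw [pdsBeta_early h, pdsP_early h]
    calc (k : ℝ) * a ^ 2
        = L / (2 * R ^ 2) * (2 * L / k * ((k : ℝ) * R * a / L) ^ 2) := by field_simp
      _ ≤ _ := by gcongr
  · have hμ' := (not_pdsEarly hμ h).1
    have hlam := pdsLam_pos hL hμ'
    have hτ := pdsTau_nonneg L μ
    have h1 : 2 * (1 + pdsTau L μ) * R * a / L * √((pdsLam L μ)⁻¹) ^ (k - pdsDelta L μ) ≤
        pdsT L μ R a k := by
      rw [pdsT_late hL hμ' h]
      exact Nat.le_ceil _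
    have h2 : (√((pdsLam L μ)⁻¹) ^ (k - pdsDelta L μ)) ^ 2 =
        ((pdsLam L μ)⁻¹) ^ (k - pdsDelta L μ) := by
      rw [← pow_mul, mul_comm, pow_mul, Real.sq_sqrt (by positivity)]
    have h3 := pdsDelta_le L μ
    rw [pdsBeta_late h, pdsP_late h]
    calc (pdsDelta L μ : ℝ) * ((pdsLam L μ)⁻¹) ^ (k - pdsDelta L μ) * a ^ 2
        ≤ (2 * pdsTau L μ + 2) * ((pdsLam L μ)⁻¹) ^ (k - pdsDelta L μ) * a ^ 2 := by gcongr
      _ = L / (2 * R ^ 2) * (L / (1 + pdsTau L μ) * (2 * (1 + pdsTau L μ) * R * a / L *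
            √((pdsLam L μ)⁻¹) ^ (k - pdsDelta L μ)) ^ 2) := by
          rw [mul_pow _ (√((pdsLam L μ)⁻¹) ^ (k - pdsDelta L μ)), h2]
          field_simp
          ring
      _ ≤ _ := by gcongr

/-- The delicate index is the switch k = Δ. There Δ ≥ 2τ + 1 gives τ_Δ ≥ τ, and Δ ≤ 2τ + 2 gives p_Δ
≥ L/(1 + τ). -/
theorem pdsParams_conditions (hL : 0 < L) (hμ : 0 ≤ μ) (hR : 0 < R) (ha : 0 < a) :
    (pdsParams L μ R a).Conditions L μ a (L / (2 * R ^ 2)) := by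
  have hτ0 := pdsTau_nonneg L μ
  have hΔ := le_pdsDelta L μ
  have hΔ' := pdsDelta_le L μ
  have hβpos : ∀ k, 1 ≤ k → 0 < pdsBeta L μ k := fun k hk => pdsBeta_pos hL hμ hk
  have hTpos : ∀ k, 1 ≤ k → (0 : ℝ) < pdsT L μ R a k := fun k hk => by
    have := pdsT_pos hL hμ hR ha hk
    positivity
  have hτe : ∀ k, PDSEarly L μ k → (pdsParams L μ R a).τ k = ((k : ℝ) - 1) / 2 :=
    fun k h => if_pos h
  have hτl : ∀ k, ¬ PDSEarly L μ k → (pdsParams L μ R a).τ k = pdsTau L μ := fun k h => if_neg h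
  have hle : ∀ k, PDSEarly L μ k → (pdsParams L μ R a).lam k = ((k : ℝ) - 1) / k :=
    fun k h => if_pos h
  have hll : ∀ k, ¬ PDSEarly L μ k → (pdsParams L μ R a).lam k = pdsLam L μ := fun k h => if_neg h
  have hτnn : ∀ k, 1 ≤ k → 0 ≤ (pdsParams L μ R a).τ k := fun k hk => by
    have : (1 : ℝ) ≤ k := by exact_mod_cast hk
    by_cases h : PDSEarly L μ k
    · rw [hτe k h]; linarith
    · rw [hτl k h]; exact hτ0
  have hcase : ∀ k, PDSEarly L μ k → ¬ PDSEarly L μ (k + 1) → k = pdsDelta L μ := fun k h h' => by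
    obtain ⟨h1, h2⟩ := not_pdsEarly hμ h'
    rcases h with h | h
    · exact absurd h h1.ne'
    · lia
  refine
    { c_pos := by positivity
      β_pos := hβpos
      T_pos := fun k hk => pdsT_pos hL hμ hR ha hk
      p_nonneg := fun k hk => (pdsP_pos hL hk).le
      τ_nonneg := hτnn
      τ_one := by rw [hτe 1 (pdsEarly_one L μ)]; simp
      lam_one := by rw [hle 1 (pdsEarly_one L μ)]; simp
      β_one_mul_p_one := ?_
      τ_pos := ?_
      β_mul_lam := ?_
      β_mul_τ_le := ?_
      lam_mul_L_le := ?_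
      L_le := ?_
      β_mul_p_le := ?_
      η_eq := fun k hk t => rfl
      β_mul_q := ?_
      sq_mul_le := ?_
      α_one := ?_
      α_eq := fun k t ht => if_neg (by lia) }
  · change pdsBeta L μ 1 * pdsP L μ 1 = 2 * L
    rw [pdsBeta_early (pdsEarly_one L μ), pdsP_early (pdsEarly_one L μ)]
    simp
  · intro k hk
    by_cases h : PDSEarly L μ (k + 1)
    · rw [hτe _ h]
      push_cast
      rw [add_sub_cancel_right]
      positivity
    · rw [hτl _ h]
      exact pdsTau_pos hL (not_pdsEarly hμ h).1
  · intro k hk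
    change pdsBeta L μ (k + 1) * _ = pdsBeta L μ k
    by_cases h : PDSEarly L μ (k + 1)
    · rw [hle _ h, pdsBeta_early h, pdsBeta_early h.of_succ]
      push_cast
      field_simp
      ring
    · rw [hll _ h]
      exact pdsBeta_succ_mul_lam hL hμ h
  · intro k hk
    change pdsBeta L μ (k + 1) * _ ≤ pdsBeta L μ k * _
    by_cases h : PDSEarly L μ (k + 1)
    · rw [hτe _ h, hτe _ h.of_succ, pdsBeta_early h, pdsBeta_early h.of_succ]
      push_cast
      apply le_of_eq
      ring
    · rw [hτl _ h, ← pdsBeta_succ_mul_lam hL hμ h]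
      have hβ := hβpos (k + 1) (by lia)
      have h1 : pdsTau L μ ≤ (pdsParams L μ R a).τ k := by
        by_cases h' : PDSEarly L μ k
        · rw [hτe k h', hcase k h' h]; linarith
        · rw [hτl k h']
      have := pdsLam_pos hL (not_pdsEarly hμ h).1
      calc pdsBeta L μ (k + 1) * pdsTau L μ
          = pdsBeta L μ (k + 1) * pdsLam L μ * (1 + pdsTau L μ) := by rw [mul_assoc, pdsLam_mul]
        _ ≤ _ := by gcongr
  · intro k hk
    change _ ≤ _ * pdsP L μ k
    by_cases h : PDSEarly L μ (k + 1)
    · rw [hle _ h, hτe _ h, pdsP_early h.of_succ]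
      have hk' : (0 : ℝ) < k := by positivity
      push_cast
      rw [add_sub_cancel_right]
      have h1 : (k : ℝ) / 2 * (2 * L / k) = L := by field_simp
      rw [h1]
      have h2 : (k : ℝ) / (k + 1) ≤ 1 := (div_le_one (by positivity)).2 (by linarith)
      nlinarith
    · rw [hll _ h, hτl _ h]
      have h1 : L / (1 + pdsTau L μ) ≤ pdsP L μ k := by
        by_cases h' : PDSEarly L μ k
        · have hk' : (0 : ℝ) < k := by positivity
          rw [pdsP_early h', div_le_div_iff₀ (by positivity) hk', hcase k h' h]
          nlinarith
        · rw [pdsP_late h']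
      calc pdsLam L μ * L = pdsTau L μ * (L / (1 + pdsTau L μ)) := by rw [pdsLam]; ring
        _ ≤ _ := by gcongr
  · intro k hk
    change L ≤ pdsP L μ k * _
    by_cases h : PDSEarly L μ k
    · have hk' : (0 : ℝ) < k := by positivity
      rw [hτe _ h, pdsP_early h, div_mul_eq_mul_div, le_div_iff₀ hk']
      nlinarith
    · rw [hτl _ h, pdsP_late h, div_mul_cancel₀ _ (by positivity)]
  · intro k hk
    change pdsBeta L μ (k + 1) * (2 * pdsP L μ (k + 1)) ≤ pdsBeta L μ k * (2 * pdsP L μ k + μ)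
    by_cases h : PDSEarly L μ (k + 1)
    · have hk' : (0 : ℝ) < k := by positivity
      rw [pdsBeta_early h, pdsBeta_early h.of_succ, pdsP_early h, pdsP_early h.of_succ]
      have h1 : ((k + 1 : ℕ) : ℝ) * (2 * (2 * L / (k + 1 : ℕ))) = 4 * L := by
        field_simp; ring
      have h2 : (k : ℝ) * (2 * (2 * L / k) + μ) = 4 * L + k * μ := by
        field_simp; ring
      rw [h1, h2]
      have : 0 ≤ (k : ℝ) * μ := by positivity
      linarith
    · have hμ' := (not_pdsEarly hμ h).1
      have hτ := pdsTau_pos hL hμ'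
      have hsq := pdsTau_sq_mul hL hμ'
      have hβ := hβpos k hk
      have hlam := pdsLam_pos hL hμ'
      -- By τ²μ = 2L the left side is β_k τ μ, so what remains is τ μ ≤ 2 p_k + μ.
      have h1 : pdsBeta L μ (k + 1) * (2 * pdsP L μ (k + 1)) =
          pdsBeta L μ k * (pdsTau L μ * μ) := by
        rw [← pdsBeta_succ_mul_lam hL hμ h, pdsP_late h, pdsLam]
        field_simp
        rw [mul_assoc _ (pdsTau L μ ^ 2), hsq]
        ring
      rw [h1]
      refine mul_le_mul_of_nonneg_left ?_ hβ.le
      by_cases h' : PDSEarly L μ k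
      · have hk' : (0 : ℝ) < k := by positivity
        rw [pdsP_early h']
        have h3 : 2 * (2 * L / (k : ℝ)) = 2 * pdsTau L μ ^ 2 * μ / k := by
          rw [mul_assoc, hsq]; ring
        rw [h3, ← sub_le_iff_le_add, le_div_iff₀ hk', hcase k h' h]
        -- The upper bound on Δ may be multiplied by (τ - 1)μ only if τ ≥ 1; otherwise that product
        -- is nonpositive and nothing is needed.
        rcases le_total (pdsTau L μ) 1 with h4 | h4
        · have h5 : (pdsTau L μ * μ - μ) * (pdsDelta L μ : ℝ) ≤ 0 :=
            mul_nonpos_of_nonpos_of_nonneg (by nlinarith) (by positivity)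
          have h6 : 0 ≤ 2 * pdsTau L μ ^ 2 * μ := by positivity
          linarith
        · have h5 : (pdsTau L μ * μ - μ) * (pdsDelta L μ : ℝ) ≤
              (pdsTau L μ * μ - μ) * (2 * pdsTau L μ + 2) :=
            mul_le_mul_of_nonneg_left hΔ' (by nlinarith)
          nlinarith
      · rw [pdsP_late h']
        have h3 : pdsTau L μ * μ - μ ≤ 2 * (L / (1 + pdsTau L μ)) := by
          rw [← mul_div_assoc, le_div_iff₀ (by positivity)]
          nlinarith
        linarith
  · intro k hk t
    have hβ := hβpos k hk
    have hT := hTpos k hk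
    change pdsBeta L μ k / (pdsT L μ R a k : ℝ) *
      (L * (pdsT L μ R a k : ℝ) / (2 * pdsBeta L μ k * R ^ 2)) = L / (2 * R ^ 2)
    field_simp
  · intro k hk t ht
    have hT := hTpos k hk
    have hp := pdsP_pos (μ := μ) hL hk
    have ht' : (1 : ℝ) ≤ t := by exact_mod_cast ht
    change pdsBeta L μ k / (pdsT L μ R a k : ℝ) * a ^ 2 ≤ L / (2 * R ^ 2) *
      ((pdsP L μ k + μ) * ((t : ℝ) - 1) + pdsP L μ k * (pdsT L μ R a k : ℝ))
    have h1 := pdsBeta_mul_sq_le hL hμ hR ha hk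
    calc pdsBeta L μ k / (pdsT L μ R a k : ℝ) * a ^ 2
        = pdsBeta L μ k * a ^ 2 / (pdsT L μ R a k : ℝ) := by ring
      _ ≤ L / (2 * R ^ 2) * (pdsP L μ k * (pdsT L μ R a k : ℝ) ^ 2) / (pdsT L μ R a k : ℝ) := by
          gcongr
      _ = L / (2 * R ^ 2) * (pdsP L μ k * (pdsT L μ R a k : ℝ)) := by field_simp
      _ ≤ _ := by
          refine mul_le_mul_of_nonneg_left ?_ (by positivity)
          have : 0 ≤ (pdsP L μ k + μ) * ((t : ℝ) - 1) :=
            mul_nonneg (by positivity) (by linarith)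
          linarith
  · intro k hk
    have hβ := hβpos (k + 1) (by lia)
    have hT := hTpos (k + 1) (by lia)
    have hT' := hTpos k hk
    have h1 : (pdsParams L μ R a).α (k + 1) 1 =
        pdsBeta L μ k * (pdsT L μ R a (k + 1) : ℝ) /
          (pdsBeta L μ (k + 1) * (pdsT L μ R a k : ℝ)) :=
      if_pos ⟨by lia, rfl⟩
    rw [h1]
    change pdsBeta L μ (k + 1) / (pdsT L μ R a (k + 1) : ℝ) * _ =
      pdsBeta L μ k / (pdsT L μ R a k : ℝ)
    field_simp

/-- Late weights grow at least linearly: 1/λ = 1 + 1/τ, so Bernoulli gives Δ λ^{-j} ≥ Δ + jΔ/τ, and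
Δ ≥ τ. -/
theorem le_pdsBeta (hL : 0 < L) (hμ : 0 ≤ μ) (k : ℕ) : (k : ℝ) ≤ pdsBeta L μ k := by
  by_cases h : PDSEarly L μ k
  · rw [pdsBeta_early h]
  · obtain ⟨hμ', hk⟩ := not_pdsEarly hμ h
    have hτ := pdsTau_pos hL hμ'
    have hΔ := le_pdsDelta L μ
    rw [pdsBeta_late h]
    obtain ⟨j, rfl⟩ := Nat.exists_eq_add_of_lt hk
    rw [(by lia : pdsDelta L μ + j + 1 - pdsDelta L μ = j + 1)]
    have h1 : (pdsLam L μ)⁻¹ = 1 + (pdsTau L μ)⁻¹ := by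
      rw [pdsLam]; field_simp; ring
    have h2 := one_add_mul_le_pow (a := (pdsTau L μ)⁻¹) (by have := inv_pos.2 hτ; linarith) (j + 1)
    rw [h1]
    push_cast at h2 ⊢
    have h3 : (1 : ℝ) ≤ pdsDelta L μ * (pdsTau L μ)⁻¹ := by
      rw [← div_eq_mul_inv, one_le_div hτ]; linarith
    have h4 := mul_le_mul_of_nonneg_left h2 (Nat.cast_nonneg (α := ℝ) (pdsDelta L μ))
    have h5 := mul_le_mul_of_nonneg_left h3 (by positivity : (0 : ℝ) ≤ (j : ℝ) + 1)
    linarith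

theorem sq_div_two_le_sum_pdsBeta (hL : 0 < L) (hμ : 0 ≤ μ) (N : ℕ) :
    (N : ℝ) ^ 2 / 2 ≤ ∑ k ∈ Finset.Icc 1 N, pdsBeta L μ k := by
  induction N with
  | zero => simp
  | succ n ih =>
    rw [Finset.sum_Icc_succ_top (by lia)]
    have := le_pdsBeta hL hμ (n + 1)
    push_cast at this ⊢
    linarith

/-- The geometric bound already follows from the last weight alone. In the early phase it is
trivial, as λ^{N-Δ} ≥ 1. -/
theorem inv_sum_pdsBeta_le_rate (hL : 0 < L) (hμ : 0 ≤ μ) {N : ℕ} (hN : 1 ≤ N) :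
    (∑ k ∈ Finset.Icc 1 N, pdsBeta L μ k)⁻¹ ≤ pdsRate L μ N := by
  have hN' : (0 : ℝ) < N := by positivity
  have h1 : (∑ k ∈ Finset.Icc 1 N, pdsBeta L μ k)⁻¹ ≤ 2 / (N : ℝ) ^ 2 := by
    rw [← inv_div]
    exact inv_anti₀ (by positivity) (sq_div_two_le_sum_pdsBeta hL hμ N)
  rw [pdsRate]
  split_ifs with h0
  · exact h1
  refine le_min h1 ?_
  have hμ' := hμ.lt_of_ne' h0
  have hlam := pdsLam_pos hL hμ'
  have hmem : N ∈ Finset.Icc 1 N := by simp [hN]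
  have h2 : pdsBeta L μ N ≤ ∑ k ∈ Finset.Icc 1 N, pdsBeta L μ k :=
    Finset.single_le_sum (fun k hk => (pdsBeta_pos hL hμ (Finset.mem_Icc.1 hk).1).le) hmem
  refine (inv_anti₀ (pdsBeta_pos hL hμ hN) h2).trans ?_
  have hΔ : (1 : ℝ) ≤ pdsDelta L μ := by exact_mod_cast one_le_pdsDelta L μ
  by_cases h : PDSEarly L μ N
  · have h3 : (N : ℤ) - pdsDelta L μ ≤ 0 := by
      rcases h with h | h
      · exact absurd h h0
      · lia
    have h4 : (1 : ℝ) ≤ N := by exact_mod_cast hN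
    rw [pdsBeta_early h]
    refine (inv_le_one_of_one_le₀ h4).trans ?_
    rw [← neg_neg ((N : ℤ) - pdsDelta L μ), zpow_neg, ← inv_zpow]
    exact one_le_zpow₀ ((one_le_inv₀ hlam).2 (pdsLam_lt_one L μ).le) (by lia)
  · rw [pdsBeta, if_neg h, zpow_neg, mul_inv, inv_inv]
    exact mul_le_of_le_one_left (by positivity) (inv_le_one_of_one_le₀ hΔ)

end Parameters

namespace PDSIterates

variable {E : Type u} [NormedAddCommGroup E] [NormedSpace ℝ E]
  {F : Type v} [NormedAddCommGroup F] [NormedSpace ℝ F]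
  {r : PDSIterates E F} {S : BilinearSPP E F} {x₀ : E} {z₀ : F} {N : ℕ} {R : ℝ}

theorem IsRun.gap_output_le_pdsRate (hR : 0 < R) (hA : S.A ≠ 0) (hN : 1 ≤ N)
    (hr : r.IsRun S (pdsParams S.L S.μ R ‖S.A‖) x₀ z₀ N) {x : E} (hx : x ∈ S.X)
    {y : StrongDual ℝ E} (hy : y ∈ S.Y) {z : F} (hz : z ∈ S.Z) :
    S.gap (r.output (pdsParams S.L S.μ R ‖S.A‖) N) (x, y, z) ≤
      pdsRate S.L S.μ N * (S.L / (2 * R ^ 2) * S.U z₀ z + 4 * S.L * S.V x₀ x) := by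
  have hL := S.L_pos
  have hP := pdsParams_conditions S.L_pos S.μ_nonneg hR ((norm_pos_iff (a := S.A)).2 hA)
  refine (hr.gap_output_le hP hN hx hy hz).trans ?_
  have hU := S.U_nonneg hr.z_zero_mem hz
  have hV := S.V_nonneg hr.x_zero_mem hx
  exact mul_le_mul_of_nonneg_right (inv_sum_pdsBeta_le_rate S.L_pos S.μ_nonneg hN) (by positivity)

end PDSIterates

/-! ### Complexity -/

namespace PDSIterates

variable {E : Type u} [NormedAddCommGroup E] [NormedSpace ℝ E]
  {F : Type v} [NormedAddCommGroup F] [NormedSpace ℝ F]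

theorem gradientEvals_eq (r : PDSIterates E F) (P : PDSParams) (N : ℕ) :
    r.gradientEvals P N = N := by
  induction N with
  | zero => rfl
  | succ n ih =>
    rw [gradientEvals] at ih ⊢
    rw [oracleCalls, List.countP_append, ih]
    simp [List.countP_flatMap, OracleCall.isGradient, Function.comp_def]

theorem operatorEvals_eq (r : PDSIterates E F) (P : PDSParams) (N : ℕ) :
    r.operatorEvals P N = 2 * ∑ k ∈ Finset.Icc 1 N, P.T k := by
  induction N with
  | zero => rfl
  | succ n ih =>
    rw [operatorEvals] at ih ⊢
    rw [oracleCalls, List.countP_append, ih, Finset.sum_Icc_succ_top (by lia)]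
    simp [List.countP_flatMap, OracleCall.isGradient, Function.comp_def]
    ring

variable {r : PDSIterates E F} {S : BilinearSPP E F} {x₀ xs : E} {z₀ zs : F} {N : ℕ}

theorem IsRun.isEpsSolution {ρ ε : ℝ} (hA : S.A ≠ 0) (hv : 0 < S.V x₀ xs) (hρ : 0 < ρ) (hN : 1 ≤ N)
    (hrate : pdsRate S.L S.μ N * (12 * ρ * (S.L * S.V x₀ xs)) ≤ ε)
    (hr : r.IsRun S (pdsParams S.L S.μ ((‖zs‖ + 1) / (4 * √(S.V x₀ xs))) ‖S.A‖) x₀ z₀ N) :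
    S.IsEpsSolution x₀ z₀ xs zs ρ ε
      (r.output (pdsParams S.L S.μ ((‖zs‖ + 1) / (4 * √(S.V x₀ xs))) ‖S.A‖) N) := by
  have hL := S.L_pos
  have hsv : 0 < √(S.V x₀ xs) := Real.sqrt_pos.2 hv
  have hR : 0 < (‖zs‖ + 1) / (4 * √(S.V x₀ xs)) := by positivity
  have hP := pdsParams_conditions S.L_pos S.μ_nonneg hR ((norm_pos_iff (a := S.A)).2 hA)
  refine ⟨hr.output_mem_feasible hP hN, fun x hx y hy z hz hVx hUz => ?_⟩
  refine (hr.gap_output_le_pdsRate hR hA hN hx hy hz).trans (le_trans ?_ hrate)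
  have hrate0 : 0 ≤ pdsRate S.L S.μ N :=
    (inv_nonneg.2 (sum_β_pos hP hN).le).trans (inv_sum_pdsBeta_le_rate S.L_pos S.μ_nonneg hN)
  refine mul_le_mul_of_nonneg_left ?_ hrate0
  -- The choice of R cancels |z*| + 1. The dual term contributes 8ρ and the primal term 4ρ, hence
  -- the factor 12ρ.
  have h1 : S.L / (2 * ((‖zs‖ + 1) / (4 * √(S.V x₀ xs))) ^ 2) * (ρ * (‖zs‖ + 1) ^ 2) =
      8 * ρ * (S.L * S.V x₀ xs) := by
    rw [div_pow, mul_pow, Real.sq_sqrt hv.le]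
    field_simp
    ring
  have h2 := mul_le_mul_of_nonneg_left hUz
    (by positivity : 0 ≤ S.L / (2 * ((‖zs‖ + 1) / (4 * √(S.V x₀ xs))) ^ 2))
  have h3 := mul_le_mul_of_nonneg_left hVx (by positivity : 0 ≤ 4 * S.L)
  linarith

end PDSIterates

section Complexity

variable {L μ R a : ℝ}

theorem sum_pdsT_early_le (hL : 0 < L) (hR : 0 ≤ R) (ha : 0 ≤ a) {n : ℕ}
    (h : ∀ k ≤ n, PDSEarly L μ k) :
    ∑ k ∈ Finset.Icc 1 n, (pdsT L μ R a k : ℝ) ≤ n + n ^ 2 * (R * a / L) := by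
  have h1 : ∀ k ∈ Finset.Icc 1 n, (pdsT L μ R a k : ℝ) ≤ 1 + n * (R * a / L) := fun k hk => by
    have hkn := (Finset.mem_Icc.1 hk).2
    rw [pdsT_early (h k hkn)]
    have h2 := (Nat.ceil_lt_add_one (by positivity : 0 ≤ (k : ℝ) * R * a / L)).le
    have h3 : (k : ℝ) * R * a / L ≤ n * (R * a / L) := by
      rw [mul_assoc, mul_div_assoc]
      gcongr
    linarith
  refine (Finset.sum_le_card_nsmul _ _ _ h1).trans (le_of_eq ?_)
  rw [Nat.card_Icc, Nat.add_sub_cancel, nsmul_eq_mul]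
  ring

theorem one_lt_sqrt_inv_pdsLam (hL : 0 < L) (hμ : 0 < μ) : 1 < √((pdsLam L μ)⁻¹) := by
  rw [Real.lt_sqrt zero_le_one, one_pow]
  exact (one_lt_inv₀ (pdsLam_pos hL hμ)).2 (pdsLam_lt_one L μ)

theorem sum_pdsT_late_le (hL : 0 < L) (hμ : 0 < μ) (hR : 0 ≤ R) (ha : 0 ≤ a) (M : ℕ) :
    ∑ k ∈ Finset.Icc 1 (pdsDelta L μ + M), (pdsT L μ R a k : ℝ) ≤
      ((pdsDelta L μ + M : ℕ) : ℝ) + (pdsDelta L μ : ℝ) ^ 2 * (R * a / L)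
        + 2 * (1 + pdsTau L μ) * R * a / L
          * (√((pdsLam L μ)⁻¹) / (√((pdsLam L μ)⁻¹) - 1)) * (√((pdsLam L μ)⁻¹) ^ M - 1) := by
  have hσ := one_lt_sqrt_inv_pdsLam hL hμ
  set σ := √((pdsLam L μ)⁻¹)
  have hτ := pdsTau_nonneg L μ
  induction M with
  | zero =>
    simpa using sum_pdsT_early_le (L := L) (μ := μ) hL hR ha (n := pdsDelta L μ)
      fun k hk => Or.inr hk
  | succ M ih =>
    have hlate : ¬ PDSEarly L μ (pdsDelta L μ + (M + 1)) := by
      rw [PDSEarly, not_or]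
      exact ⟨hμ.ne', by lia⟩
    have h1 : (pdsT L μ R a (pdsDelta L μ + (M + 1)) : ℝ) ≤
        2 * (1 + pdsTau L μ) * R * a / L * σ ^ (M + 1) + 1 := by
      rw [pdsT_late hL hμ hlate, Nat.add_sub_cancel_left]
      exact (Nat.ceil_lt_add_one (by positivity)).le
    rw [← add_assoc, Finset.sum_Icc_succ_top (by lia), add_assoc (pdsDelta L μ)]
    -- Induction step for the geometric sum; the +1 from each rounding is collected in the term Δ +
    -- M.
    have h2 : σ / (σ - 1) * (σ ^ (M + 1) - 1) = σ / (σ - 1) * (σ ^ M - 1) + σ ^ (M + 1) := by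
      have : σ - 1 ≠ 0 := by linarith
      field_simp
      ring
    rw [mul_assoc _ (σ / (σ - 1)), h2]
    push_cast at ih ⊢
    linarith

/-- From log λ ≤ λ - 1; this converts logarithms to base 1/λ into the factor 1 + τ. -/
theorem inv_le_log_inv_pdsLam (hL : 0 < L) (hμ : 0 < μ) :
    (1 + pdsTau L μ)⁻¹ ≤ Real.log (pdsLam L μ)⁻¹ := by
  have hlam := pdsLam_pos hL hμ
  have hτ := pdsTau_nonneg L μ
  have h1 := Real.log_le_sub_one_of_pos hlam
  have h2 : pdsLam L μ - 1 = -(1 + pdsTau L μ)⁻¹ := by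
    rw [pdsLam]
    field_simp
    ring
  rw [Real.log_inv]
  linarith

/-- The lower bound secures the accuracy, the upper bound limits the cost; M = 0 covers K ≤ 1. -/
theorem exists_pow_between {δ K : ℝ} (hδ : 1 < δ) :
    ∃ M : ℕ, K ≤ δ ^ M ∧ (M = 0 ∨ δ ^ M ≤ δ * K) := by
  rcases le_total K 1 with h | h
  · exact ⟨0, by simpa using h, Or.inl rfl⟩
  · obtain ⟨n, h1, h2⟩ := exists_nat_pow_near h hδ
    refine ⟨n + 1, h2.le, Or.inr ?_⟩
    rw [pow_succ, mul_comm]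
    exact mul_le_mul_of_nonneg_left h1 (by linarith)

/-- Applied with t = L v₀/ε, this lets multiples of τ be absorbed into τ log(L v₀/ε). -/
theorem half_le_log {t : ℝ} (ht : 2 ≤ t) : 1 / 2 ≤ Real.log t := by
  have h1 := Real.log_le_log (by norm_num) ht
  have h2 := Real.log_two_gt_d9
  linarith

/-- The number of late iterations needed for a geometric decrease by the factor `K`. -/
theorem late_iterations_le (hL : 0 < L) (hμ : 0 < μ) {K : ℝ} (hK : 0 < K) {M : ℕ}
    (hM : M = 0 ∨ (pdsLam L μ)⁻¹ ^ M ≤ (pdsLam L μ)⁻¹ * K) {ℓ : ℝ} (hℓ : 0 ≤ ℓ)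
    (hKℓ : Real.log K ≤ ℓ) : (M : ℝ) ≤ 1 + (1 + pdsTau L μ) * ℓ := by
  have hτ := pdsTau_nonneg L μ
  rcases hM with rfl | hM
  · have : 0 ≤ (1 + pdsTau L μ) * ℓ := by positivity
    simp only [Nat.cast_zero]
    linarith
  have hδ : 0 < (pdsLam L μ)⁻¹ := inv_pos.2 (pdsLam_pos hL hμ)
  have h1 := Real.log_le_log (by positivity) hM
  rw [Real.log_pow, Real.log_mul hδ.ne' hK.ne'] at h1
  have h2 := inv_le_log_inv_pdsLam hL hμ
  rcases Nat.eq_zero_or_pos M with rfl | hM1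
  · have : 0 ≤ (1 + pdsTau L μ) * ℓ := by positivity
    simp only [Nat.cast_zero]
    linarith
  have h3 : (1 : ℝ) ≤ M := by exact_mod_cast hM1
  have h4 : ((M : ℝ) - 1) * (1 + pdsTau L μ)⁻¹ ≤ ℓ := by
    have := mul_le_mul_of_nonneg_left h2 (sub_nonneg.2 h3)
    linarith
  rw [← div_eq_mul_inv, div_le_iff₀ (by positivity)] at h4
  linarith

end Complexity

/-- The order of quantifiers expresses the uniformity: `Co` is fixed before the spaces, A and ε, and
N before the run. -/
theorem complexity_of_mu_eq_zero (ρ : ℝ) (hρ : 0 < ρ) : ∃ Cg : ℝ, ∀ L v₀ s : ℝ, 0 < L → 0 < v₀ →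
    0 ≤ s → ∃ Co : ℝ,
      ∀ (E : Type u) [NormedAddCommGroup E] [NormedSpace ℝ E]
        (F : Type v) [NormedAddCommGroup F] [NormedSpace ℝ F]
        (S : BilinearSPP E F) (x₀ xs : E) (z₀ zs : F) (ε : ℝ),
        S.L = L → S.μ = 0 → S.A ≠ 0 → S.V x₀ xs = v₀ → ‖zs‖ = s → 0 < ε → ε ≤ L * v₀ / 2 →
        ∃ N : ℕ, 1 ≤ N ∧ ∀ r : PDSIterates E F,
          (r.gradientEvals (pdsParams L 0 ((s + 1) / (4 * √v₀)) ‖S.A‖) N : ℝ) ≤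
            Cg * √(L * v₀ / ε) ∧
          (r.operatorEvals (pdsParams L 0 ((s + 1) / (4 * √v₀)) ‖S.A‖) N : ℝ) ≤
            Co * (√(L * v₀ / ε) + ‖S.A‖ / ε) ∧
          (r.IsRun S (pdsParams L 0 ((s + 1) / (4 * √v₀)) ‖S.A‖) x₀ z₀ N →
            S.IsEpsSolution x₀ z₀ xs zs ρ ε
              (r.output (pdsParams L 0 ((s + 1) / (4 * √v₀)) ‖S.A‖) N)) := by
  -- N is √(24ρ L v₀/ε) rounded up, which solves (2/N²)·12ρ L v₀ ≤ ε; the +1 absorbs the rounding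
  -- because L v₀/ε ≥ 1.
  refine ⟨√(24 * ρ) + 1, fun L v₀ s hL hv hs =>
    ⟨2 * (√(24 * ρ) + 1) + 2 * (√(24 * ρ) + 1) ^ 2 * v₀ * ((s + 1) / (4 * √v₀)), ?_⟩⟩
  intro E _ _ F _ _ S x₀ xs z₀ zs ε hSL hSμ hA hV hzs hε hεle
  set C := √(24 * ρ) + 1 with hC
  set R := (s + 1) / (4 * √v₀) with hR
  set q := √(L * v₀ / ε) with hq
  have hsv : 0 < √v₀ := Real.sqrt_pos.2 hv
  have hR0 : 0 ≤ R := by positivity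
  have hC0 : 0 ≤ C := by positivity
  have ha : 0 ≤ ‖S.A‖ := norm_nonneg S.A
  have hratio : 1 ≤ L * v₀ / ε := by
    rw [le_div_iff₀ hε]
    have : 0 < L * v₀ := by positivity
    linarith
  have hq1 : 1 ≤ q := Real.one_le_sqrt.2 hratio
  have hq2 : q ^ 2 = L * v₀ / ε := Real.sq_sqrt (by positivity)
  have hmul : 0 < √(24 * ρ) * q := by positivity
  have hNle : ((⌈√(24 * ρ) * q⌉₊ : ℕ) : ℝ) ≤ C * q := by
    have := (Nat.ceil_lt_add_one hmul.le).le
    rw [hC, add_mul]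
    linarith
  have hNge : √(24 * ρ) * q ≤ ((⌈√(24 * ρ) * q⌉₊ : ℕ) : ℝ) := Nat.le_ceil _
  have hN1 : 1 ≤ ⌈√(24 * ρ) * q⌉₊ := Nat.one_le_ceil_iff.2 hmul
  generalize ⌈√(24 * ρ) * q⌉₊ = N at hNle hNge hN1
  refine ⟨N, hN1, fun r => ⟨?_, ?_, fun hr => ?_⟩⟩
  · rw [r.gradientEvals_eq]
    exact hNle
  · rw [r.operatorEvals_eq]
    have h1 := sum_pdsT_early_le (μ := 0) (n := N) hL hR0 ha fun k _ => Or.inl rfl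
    have h2 : (N : ℝ) ^ 2 ≤ (C * q) ^ 2 := by gcongr
    have h3 : (C * q) ^ 2 * (R * ‖S.A‖ / L) = C ^ 2 * v₀ * R * (‖S.A‖ / ε) := by
      rw [mul_pow, hq2]
      field_simp
    have h4 := mul_le_mul_of_nonneg_right h2 (by positivity : 0 ≤ R * ‖S.A‖ / L)
    have h5 : 0 ≤ C * (‖S.A‖ / ε) := by positivity
    have h6 : 0 ≤ C ^ 2 * v₀ * R * q := by positivity
    change ((2 * ∑ k ∈ Finset.Icc 1 N, pdsT L 0 R ‖S.A‖ k : ℕ) : ℝ) ≤ _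
    push_cast
    linarith
  · subst hSL hV hzs
    rw [← hSμ] at hr ⊢
    refine hr.isEpsSolution hA hv hρ hN1 ?_
    rw [pdsRate, if_pos hSμ, div_mul_eq_mul_div, div_le_iff₀ (by positivity)]
    have h1 : (√(24 * ρ) * q) ^ 2 ≤ (N : ℝ) ^ 2 := by gcongr
    rw [mul_pow, Real.sq_sqrt (by positivity), hq2] at h1
    have h2 := mul_le_mul_of_nonneg_left h1 hε.le
    have h3 : ε * (24 * ρ * (S.L * S.V x₀ xs / ε)) = 2 * (12 * ρ * (S.L * S.V x₀ xs)) := by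
      field_simp
      ring
    linarith

theorem complexity_of_mu_pos (ρ κ : ℝ) (hρ : 0 < ρ) (hκ : 0 < κ) : ∃ Cg : ℝ, ∀ L μ v₀ s : ℝ,
      0 < L → 0 < μ → μ ≤ κ * L → 0 < v₀ → 0 ≤ s → ∃ Co : ℝ,
      ∀ (E : Type u) [NormedAddCommGroup E] [NormedSpace ℝ E]
        (F : Type v) [NormedAddCommGroup F] [NormedSpace ℝ F]
        (S : BilinearSPP E F) (x₀ xs : E) (z₀ zs : F) (ε : ℝ),
        S.L = L → S.μ = μ → S.A ≠ 0 → S.V x₀ xs = v₀ → ‖zs‖ = s → 0 < ε → ε ≤ L * v₀ / 2 →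
        ∃ N : ℕ, 1 ≤ N ∧ ∀ r : PDSIterates E F,
          (r.gradientEvals (pdsParams L μ ((s + 1) / (4 * √v₀)) ‖S.A‖) N : ℝ) ≤
            Cg * (1 + √(2 * L / μ) * Real.log (L * v₀ / ε)) ∧
          (r.operatorEvals (pdsParams L μ ((s + 1) / (4 * √v₀)) ‖S.A‖) N : ℝ) ≤
            Co * (1 + √(2 * L / μ) * Real.log (L * v₀ / ε) + ‖S.A‖ * (1 + 1 / √ε)) ∧
          (r.IsRun S (pdsParams L μ ((s + 1) / (4 * √v₀)) ‖S.A‖) x₀ z₀ N →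
            S.IsEpsSolution x₀ z₀ xs zs ρ ε
              (r.output (pdsParams L μ ((s + 1) / (4 * √v₀)) ‖S.A‖) N)) := by
  refine ⟨8 + 3 * |Real.log (12 * ρ)| + √(κ / 2), fun L μ v₀ s hL hμ hμκ hv hs => ?_⟩
  set D := |Real.log (12 * ρ)| with hD
  set C := 8 + 3 * D + √(κ / 2) with hC
  set R := (s + 1) / (4 * √v₀) with hR
  change ∃ Co, ∀ (E : Type u) [NormedAddCommGroup E] [NormedSpace ℝ E]
        (F : Type v) [NormedAddCommGroup F] [NormedSpace ℝ F]
        (S : BilinearSPP E F) (x₀ xs : E) (z₀ zs : F) (ε : ℝ),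
        S.L = L → S.μ = μ → S.A ≠ 0 → S.V x₀ xs = v₀ → ‖zs‖ = s → 0 < ε → ε ≤ L * v₀ / 2 →
        ∃ N : ℕ, 1 ≤ N ∧ ∀ r : PDSIterates E F,
          (r.gradientEvals (pdsParams L μ R ‖S.A‖) N : ℝ) ≤
            C * (1 + pdsTau L μ * Real.log (L * v₀ / ε)) ∧
          (r.operatorEvals (pdsParams L μ R ‖S.A‖) N : ℝ) ≤
            Co * (1 + pdsTau L μ * Real.log (L * v₀ / ε) + ‖S.A‖ * (1 + 1 / √ε)) ∧
          (r.IsRun S (pdsParams L μ R ‖S.A‖) x₀ z₀ N →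
            S.IsEpsSolution x₀ z₀ xs zs ρ ε (r.output (pdsParams L μ R ‖S.A‖) N))
  have hτ := pdsTau_pos hL hμ
  have hσ := one_lt_sqrt_inv_pdsLam hL hμ
  have hlam := pdsLam_pos hL hμ
  set τ := pdsTau L μ with hτdef
  set lam := pdsLam L μ with hlamdef
  set σ := √(lam⁻¹) with hσdef
  set Δ := pdsDelta L μ with hΔ
  -- The geometric sum of the late T_k, with σ^M bounded by √(λ⁻¹K) for K = 12ρ L v₀/ε and the
  -- factors ‖A‖ and 1/√ε taken out.
  set B := 2 * (1 + τ) * R / L * (σ / (σ - 1)) * √(lam⁻¹ * (12 * ρ * (L * v₀))) with hB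
  have hsv : 0 < √v₀ := Real.sqrt_pos.2 hv
  have hR0 : 0 ≤ R := by positivity
  have hC0 : 0 ≤ C := by positivity
  have hσ1 : 0 < σ - 1 := sub_pos.2 hσ
  have hB0 : 0 ≤ B := by positivity
  refine ⟨2 * C + 2 * ((Δ : ℝ) ^ 2 * (R / L)) + 2 * B, ?_⟩
  intro E _ _ F _ _ S x₀ xs z₀ zs ε hSL hSμ hA hV hzs hε hεle
  have ha : 0 ≤ ‖S.A‖ := norm_nonneg S.A
  have hℓ : 1 / 2 ≤ Real.log (L * v₀ / ε) := half_le_log (by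
    rw [le_div_iff₀ hε]
    linarith)
  set ℓ := Real.log (L * v₀ / ε) with hℓdef
  have hK : 0 < 12 * ρ * (L * v₀ / ε) := by positivity
  have hlogK : Real.log (12 * ρ * (L * v₀ / ε)) ≤ D + ℓ := by
    rw [Real.log_mul (by positivity) (by positivity)]
    have := le_abs_self (Real.log (12 * ρ))
    linarith
  obtain ⟨M, hM1, hM2⟩ := exists_pow_between ((one_lt_inv₀ hlam).2 (pdsLam_lt_one L μ))
    (K := 12 * ρ * (L * v₀ / ε))
  have hMle := late_iterations_le hL hμ hK hM2 (by positivity) hlogK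
  have hNle : ((Δ + M : ℕ) : ℝ) ≤ C * (1 + τ * ℓ) := by
    have h1 := pdsDelta_le L μ
    -- The bound μ ≤ κL keeps τ away from 0, so the bare ℓ coming from (1 + τ)ℓ is at most √(κ/2) τ
    -- ℓ.
    have h2 : 1 ≤ √(κ / 2) * τ := by
      rw [hτdef, pdsTau, ← Real.sqrt_mul (by positivity)]
      refine Real.one_le_sqrt.2 ?_
      rw [div_mul_div_comm, one_le_div (by positivity)]
      linarith
    have h3 : τ ≤ 2 * (τ * ℓ) := by nlinarith
    have h4 := mul_le_mul_of_nonneg_right h2 (by linarith : 0 ≤ ℓ)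
    have h5 := mul_le_mul_of_nonneg_left h3 (abs_nonneg (Real.log (12 * ρ)))
    have h6 : 0 ≤ √(κ / 2) := by positivity
    have h7 : 0 ≤ τ * ℓ := by positivity
    have h8 : 0 ≤ D * (τ * ℓ) := by positivity
    push_cast
    linarith [abs_nonneg (Real.log (12 * ρ))]
  have hN1 : 1 ≤ Δ + M := (one_le_pdsDelta L μ).trans (Nat.le_add_right _ _)
  refine ⟨Δ + M, hN1, fun r => ⟨?_, ?_, fun hr => ?_⟩⟩
  · rw [r.gradientEvals_eq]
    exact hNle
  · rw [r.operatorEvals_eq]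
    have h1 := sum_pdsT_late_le hL hμ hR0 ha M
    have h2 : σ ^ M - 1 ≤ √(lam⁻¹ * (12 * ρ * (L * v₀))) * (1 / √ε) := by
      rcases hM2 with rfl | hM2
      · rw [pow_zero, sub_self]
        positivity
      · have h3 : σ ^ M = √(lam⁻¹ ^ M) := by
          rw [← Real.sqrt_sq (pow_nonneg (Real.sqrt_nonneg lam⁻¹) M), ← pow_mul, mul_comm, pow_mul,
            Real.sq_sqrt (by positivity)]
        have h4 := Real.sqrt_le_sqrt hM2
        rw [← h3] at h4
        have h5 : lam⁻¹ * (12 * ρ * (L * v₀ / ε)) = lam⁻¹ * (12 * ρ * (L * v₀)) / ε := by ring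
        rw [h5, Real.sqrt_div (by positivity), div_eq_mul_one_div] at h4
        linarith
    have h3 : 2 * (1 + τ) * R * ‖S.A‖ / L * (σ / (σ - 1)) * (σ ^ M - 1) ≤
        B * (‖S.A‖ * (1 / √ε)) := by
      refine (mul_le_mul_of_nonneg_left h2 (by positivity)).trans (le_of_eq ?_)
      rw [hB]
      ring
    have h4 : (Δ : ℝ) ^ 2 * (R * ‖S.A‖ / L) = (Δ : ℝ) ^ 2 * (R / L) * ‖S.A‖ := by ring
    have h5 : 0 ≤ ‖S.A‖ * (1 / √ε) := by positivity
    have h6 : 0 ≤ (Δ : ℝ) ^ 2 * (R / L) := by positivity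
    have h7 : 0 ≤ τ * ℓ := by positivity
    have h8 : 0 ≤ C * (‖S.A‖ * (1 + 1 / √ε)) := by positivity
    have h9 : 0 ≤ (Δ : ℝ) ^ 2 * (R / L) * (1 + τ * ℓ + ‖S.A‖ * (1 / √ε)) := by positivity
    have h10 : 0 ≤ B * (1 + τ * ℓ + ‖S.A‖) := by positivity
    change ((2 * ∑ k ∈ Finset.Icc 1 (Δ + M), pdsT L μ R ‖S.A‖ k : ℕ) : ℝ) ≤ _
    push_cast at h1 hNle ⊢
    linarith
  · have hrate : pdsRate L μ (Δ + M) * (12 * ρ * (L * v₀)) ≤ ε := by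
      have h1 : pdsRate L μ (Δ + M) ≤ (lam⁻¹ ^ M)⁻¹ := by
        rw [pdsRate, if_neg hμ.ne']
        refine (min_le_right _ _).trans (le_of_eq ?_)
        rw [Nat.cast_add, add_sub_cancel_left, zpow_natCast, inv_pow, inv_inv]
      refine (mul_le_mul_of_nonneg_right h1 (by positivity)).trans ?_
      rw [inv_mul_le_iff₀ (by positivity)]
      have h2 := mul_le_mul_of_nonneg_right hM1 hε.le
      have h3 : 12 * ρ * (L * v₀ / ε) * ε = 12 * ρ * (L * v₀) := by field_simp
      linarith
    subst hSL hSμ hV hzs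
    exact hr.isEpsSolution hA hv hρ hN1 hrate

theorem theorem4p2 :
    -- the gap bound, and the fact that every `y`-step is one gradient evaluation
    (∀ (E : Type u) [NormedAddCommGroup E] [NormedSpace ℝ E]
      (F : Type v) [NormedAddCommGroup F] [NormedSpace ℝ F]
      (S : BilinearSPP E F) (R : ℝ) (x₀ : E) (z₀ : F) (N : ℕ) (r : PDSIterates E F),
      0 < R → S.A ≠ 0 → 1 ≤ N →
      r.IsRun S (pdsParams S.L S.μ R ‖S.A‖) x₀ z₀ N →
      (∀ k, 1 ≤ k → k ≤ N → r.y k = fderiv ℝ S.ft (r.g k)) ∧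
      r.output (pdsParams S.L S.μ R ‖S.A‖) N ∈ S.feasible ∧
      ∀ x ∈ S.X, ∀ y ∈ S.Y, ∀ z ∈ S.Z,
        S.gap (r.output (pdsParams S.L S.μ R ‖S.A‖) N) (x, y, z) ≤
          pdsRate S.L S.μ N * (S.L / (2 * R ^ 2) * S.U z₀ z + 4 * S.L * S.V x₀ x)) ∧
    -- the complexity for `μ = 0`
    (∀ ρ : ℝ, 0 < ρ → ∃ Cg : ℝ, ∀ L v₀ s : ℝ, 0 < L → 0 < v₀ → 0 ≤ s → ∃ Co : ℝ,
      ∀ (E : Type u) [NormedAddCommGroup E] [NormedSpace ℝ E]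
        (F : Type v) [NormedAddCommGroup F] [NormedSpace ℝ F]
        (S : BilinearSPP E F) (x₀ xs : E) (z₀ zs : F) (ε : ℝ),
        S.L = L → S.μ = 0 → S.A ≠ 0 → x₀ ∈ S.X → z₀ ∈ S.Z → S.IsSaddlePoint xs zs →
        S.V x₀ xs = v₀ → ‖zs‖ = s → 0 < ε → ε ≤ L * v₀ / 2 →
        ∃ N : ℕ, 1 ≤ N ∧ ∀ r : PDSIterates E F,
          (r.gradientEvals (pdsParams L 0 ((s + 1) / (4 * √v₀)) ‖S.A‖) N : ℝ) ≤
            Cg * √(L * v₀ / ε) ∧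
          (r.operatorEvals (pdsParams L 0 ((s + 1) / (4 * √v₀)) ‖S.A‖) N : ℝ) ≤
            Co * (√(L * v₀ / ε) + ‖S.A‖ / ε) ∧
          (r.IsRun S (pdsParams L 0 ((s + 1) / (4 * √v₀)) ‖S.A‖) x₀ z₀ N →
            S.IsEpsSolution x₀ z₀ xs zs ρ ε
              (r.output (pdsParams L 0 ((s + 1) / (4 * √v₀)) ‖S.A‖) N))) ∧
    -- the complexity for `μ > 0`
    (∀ ρ κ : ℝ, 0 < ρ → 0 < κ → ∃ Cg : ℝ, ∀ L μ v₀ s : ℝ,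
      0 < L → 0 < μ → μ ≤ κ * L → 0 < v₀ → 0 ≤ s → ∃ Co : ℝ,
      ∀ (E : Type u) [NormedAddCommGroup E] [NormedSpace ℝ E]
        (F : Type v) [NormedAddCommGroup F] [NormedSpace ℝ F]
        (S : BilinearSPP E F) (x₀ xs : E) (z₀ zs : F) (ε : ℝ),
        S.L = L → S.μ = μ → S.A ≠ 0 → x₀ ∈ S.X → z₀ ∈ S.Z → S.IsSaddlePoint xs zs →
        S.V x₀ xs = v₀ → ‖zs‖ = s → 0 < ε → ε ≤ L * v₀ / 2 →
        ∃ N : ℕ, 1 ≤ N ∧ ∀ r : PDSIterates E F,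
          (r.gradientEvals (pdsParams L μ ((s + 1) / (4 * √v₀)) ‖S.A‖) N : ℝ) ≤
            Cg * (1 + √(2 * L / μ) * Real.log (L * v₀ / ε)) ∧
          (r.operatorEvals (pdsParams L μ ((s + 1) / (4 * √v₀)) ‖S.A‖) N : ℝ) ≤
            Co * (1 + √(2 * L / μ) * Real.log (L * v₀ / ε) + ‖S.A‖ * (1 + 1 / √ε)) ∧
          (r.IsRun S (pdsParams L μ ((s + 1) / (4 * √v₀)) ‖S.A‖) x₀ z₀ N →
            S.IsEpsSolution x₀ z₀ xs zs ρ ε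
              (r.output (pdsParams L μ ((s + 1) / (4 * √v₀)) ‖S.A‖) N))) := by
  refine ⟨?_, ?_, ?_⟩
  · intro E _ _ F _ _ S R x₀ z₀ N r hR hA hN hr
    have hP := pdsParams_conditions S.L_pos S.μ_nonneg hR ((norm_pos_iff (a := S.A)).2 hA)
    exact ⟨fun k hk hkN => hr.y_eq_fderiv hP hk hkN, hr.output_mem_feasible hP hN,
      fun x hx y hy z hz => hr.gap_output_le_pdsRate hR hA hN hx hy hz⟩
  · intro ρ hρ
    obtain ⟨Cg, hCg⟩ := complexity_of_mu_eq_zero.{u, v} ρ hρ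
    refine ⟨Cg, fun L v₀ s hL hv hs => ?_⟩
    obtain ⟨Co, hCo⟩ := hCg L v₀ s hL hv hs
    exact ⟨Co, fun E _ _ F _ _ S x₀ xs z₀ zs ε hSL hSμ hA _ _ _ hV hzs hε hεle =>
      hCo E F S x₀ xs z₀ zs ε hSL hSμ hA hV hzs hε hεle⟩
  · intro ρ κ hρ hκ
    obtain ⟨Cg, hCg⟩ := complexity_of_mu_pos.{u, v} ρ κ hρ hκ
    refine ⟨Cg, fun L μ v₀ s hL hμ hμκ hv hs => ?_⟩
    obtain ⟨Co, hCo⟩ := hCg L μ v₀ s hL hμ hμκ hv hs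
    exact ⟨Co, fun E _ _ F _ _ S x₀ xs z₀ zs ε hSL hSμ hA _ _ _ hV hzs hε hεle =>
      hCo E F S x₀ xs z₀ zs ε hSL hSμ hA hV hzs hε hεle⟩
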